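/- Let $\psi:[1,\infty)\to[0,\infty)$ be a decreasing function such that \[ \lim_{q\to\infty,\ q\in\mathbb N} -\frac{\log\psi(q)}{\log q}=\tau\in(2,\infty), \] and suppose that for some $\sigma>1$ one has \[ \frac{\psi(q_1)}{\psi(q_2)}\ \ge\ \Big(\frac{q_2}{q_1}\Big)^{\sigma}\qquad\text{for all sufficiently large integers } q_1<q_2 . \] Let $E(\psi)$ be the set of all $x\in\mathbb R$ such that $|x-p/q|\le\psi(q)$ for infinitely many pairs of integers $(p,q)$ with $q\ge 1$, and put $\psi^{-1}(t)=\sup\{q\ge 1:\psi(q)\ge t\}$ (the usual inverse if $\psi$ is continuous and strictly decreasing). Let $\chi$ be a real function of a real variable and $q_0$ a number such that $1\le\chi(q)\le\log q$ for all $q\ge q_0$, such that \[ \sum_{q\text{ prime}}\frac1{q\,\chi(q)}=\infty , \] and such that for every $\epsilon>0$ \[ \frac{\chi(q_2)}{\chi(q_1)}<\Big(\max\Big\{\frac{q_2}{q_1},\frac{q_1}{q_2}\Big\}\Big)^{\epsilon}\qquad\text{for all real } q_1\ne q_2 \text{ sufficiently large depending on }\epsilon . \] Let $\omega$ be any increasing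 real function on $(0,\infty)$ with $\lim_{\xi\to\infty}\omega(\xi)=\infty$. Then there is a Borel probability measure $\mu$ supported on a compact subset of $E(\psi)$ whose Fourier transform $\hat\mu(\xi)=\int e^{-2\pi i x\xi}\,d\mu(x)$ satisfies \[ |\hat\mu(\xi)|\ \le\ C\,\frac{\omega(|\xi|)}{\psi^{-1}(1/|\xi|)\,\chi\big(\psi^{-1}(1/|\xi|)\big)}\qquad\text{for all sufficiently large } |\xi| , \] with a constant $C$ depending only on $\tau$ and $\sigma$. Moreover, for every $R>0$ with $\omega(R)>0$ and $\psi^{-1}(1/R)\ge q_0$ (so that the right-hand side is defined and positive for all $|\xi|\ge R$) the same estimate holds for all $|\xi|\ge R$ with a constant that may depend on $R,\psi,\chi,\omega,\mu$ as well. In particular, if $\psi(q)=q^{-\tau}$, then \[ |\hat\mu(\xi)|\ \le\ C\,|\xi|^{-1/\tau}\,\frac{\omega(|\xi|)}{\chi(|\xi|^{1/\tau})}\qquad\text{for all sufficiently large } |\xi| . \] -/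

import Mathlib

open Filter Topology MeasureTheory

/-- The set of `ψ`-well-approximable numbers: the real `x` with `|x - p / q| ≤ ψ q` for infinitely
many pairs of integers `(p, q)` with `q ≥ 1`. -/
def approximableSet (ψ : ℝ → ℝ) : Set ℝ :=
  {x : ℝ | {a : ℤ × ℕ | 0 < a.2 ∧ |x - (a.1 : ℝ) / (a.2 : ℝ)| ≤ ψ (a.2 : ℝ)}.Infinite}

/-- The inverse of a decreasing function `ψ` on `[1, ∞)`: the supremum of the `q ≥ 1` with
`t ≤ ψ q`. If `ψ` is strictly decreasing, then its value at `t = ψ q` is `q`. If no `q ≥ 1`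
satisfies `t ≤ ψ q`, the value is the default `0`. -/
noncomputable def decreasingInverse (ψ : ℝ → ℝ) (t : ℝ) : ℝ :=
  sSup {q : ℝ | 1 ≤ q ∧ t ≤ ψ q}

/-- The Fourier transform of a measure on the real line, with kernel `exp (-2 π i ξ x)`. -/
noncomputable def measureFourier (μ : Measure ℝ) (ξ : ℝ) : ℂ :=
  ∫ x : ℝ, Complex.exp (-(2 * Real.pi * ξ * x : ℝ) * Complex.I) ∂μ

/-!
The measure is a weak limit of densities `G₀ F₁ F₂ ⋯ Fₙ`, where `G₀` is a fixed smooth bump and each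
`Fᵢ` is a nonnegative `1`-periodic function of mean `1` that lives on the `ψ`-neighbourhoods of
rationals with prime denominators `q ≥ Nᵢ`. A point of the support lies in such a neighbourhood for
every `i`, hence is `ψ`-approximable.

The point is the choice of `F` (`IsMultiplier`, `DecayData.exists_isMultiplier`). It is the average,
over finitely many primes `q ≥ N` with weights proportional to `1 / (q χ(q))`, of bumps of width
`ψ(q)` around the points `p / q`. By Poisson summation the `k`-th Fourier coefficient of `F` is at
most a constant times `∑_{q ∣ k} (1 + |k| ψ(q))⁻² / (q χ(q))`; the divergence of
`∑ 1 / (q χ(q))` over the primes makes the normalizing factor harmless. Let `D = ψ⁻¹(1 / |k|)`.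
Primes `q ≥ D` contribute at most `1 / (D χ(D))` each, and for `q < D` the hypothesis
`ψ(q) / ψ(D) ≥ (D / q) ^ σ` with `σ > 1` gains a power of `q / D`. Each contribution is therefore
`O(log q / log |k|) / (D χ(D))`, and `∑_{q ∣ k} log q ≤ log |k|`, so the coefficient is
`O(1 / (D χ(D)))` without any logarithmic loss (`DecayData.exists_prime_term_le`,
`DecayData.exists_sum_primes_le`).

Multiplying a density `G` with quadratic Fourier decay by `F` changes its Fourier transform by
`∑_{|k| ≥ N} cₖ Ĝ(ξ - k)`. This is `O(1 / (D χ(D)))` with `D = ψ⁻¹(1 / |ξ|)`, with a constant that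
depends on `G`, and it is much smaller for `|ξ| < N / 2`. Since `N` may be chosen after `G` and
`ω → ∞`, the change is at most `ε ω(|ξ|) / (D χ(D))` for any prescribed `ε`
(`DecayData.exists_mul_isDecayingDensity`). The errors add up to a small multiple of the target, so
that for large `|ξ|` the constant `2` works for all `τ` and `σ`.
-/

/-! ### The inverse function of `ψ` and the decay rate -/

/-- The standing assumptions on the approximation function `ψ` and the weight `χ`. -/
structure DecayData (τ σ q₀ : ℝ) (ψ χ : ℝ → ℝ) : Prop where
  two_lt : 2 < τ
  one_lt : 1 < σ
  anti : AntitoneOn ψ (Set.Ici 1)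
  tendsto : Tendsto (fun q : ℕ => -Real.log (ψ (q : ℝ)) / Real.log (q : ℝ)) atTop (𝓝 τ)
  nonneg : ∀ q : ℝ, 1 ≤ q → 0 ≤ ψ q
  ratio : ∃ Q : ℕ, ∀ q₁ q₂ : ℕ, Q ≤ q₁ → q₁ < q₂ →
    ((q₂ : ℝ) / (q₁ : ℝ)) ^ σ ≤ ψ (q₁ : ℝ) / ψ (q₂ : ℝ)
  chi : ∀ q : ℝ, q₀ ≤ q → 1 ≤ χ q ∧ χ q ≤ Real.log q
  slow : ∀ ε : ℝ, 0 < ε → ∃ Q : ℝ, ∀ q₁ q₂ : ℝ, Q ≤ q₁ → Q ≤ q₂ → q₁ ≠ q₂ →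
    χ q₂ / χ q₁ < (max (q₂ / q₁) (q₁ / q₂)) ^ ε

/-- The rate `1 / (D χ(D))` with `D = ψ⁻¹(1 / x)`: the Fourier decay without the factor `ω`. -/
noncomputable def decayRate (ψ χ : ℝ → ℝ) (x : ℝ) : ℝ :=
  1 / (decreasingInverse ψ (1 / x) * χ (decreasingInverse ψ (1 / x)))

theorem le_of_lt_decreasingInverse {ψ : ℝ → ℝ} (hψ : AntitoneOn ψ (Set.Ici 1)) {q t : ℝ}
    (hq : 1 ≤ q) (h : q < decreasingInverse ψ t) : t ≤ ψ q := by
  have hne : {q : ℝ | 1 ≤ q ∧ t ≤ ψ q}.Nonempty := by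
    by_contra hne
    rw [Set.not_nonempty_iff_eq_empty] at hne
    rw [decreasingInverse, hne, Real.sSup_empty] at h
    linarith
  obtain ⟨r, ⟨hr, hr'⟩, hqr⟩ := exists_lt_of_lt_csSup hne h
  exact hr'.trans (hψ hq hr hqr.le)

theorem decreasingInverse_le {ψ : ℝ → ℝ} (hψ : AntitoneOn ψ (Set.Ici 1)) {q t : ℝ}
    (hq : 1 ≤ q) (h : ψ q < t) : decreasingInverse ψ t ≤ q := by
  refine Real.sSup_le ?_ (by linarith)
  rintro r ⟨hr, hr'⟩
  by_contra! hlt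
  have := hψ hq hr hlt.le
  linarith

/-- A positive power of `b / a` dominates `log b / log a`. -/
theorem log_le_rpow_mul_log {s a b : ℝ} (hs : 0 < s) (ha : 2 ≤ a) (hab : a ≤ b) :
    Real.log b ≤ (b / a) ^ s * ((1 + 1 / (s * Real.log 2)) * Real.log a) := by
  have hl2 : 0 < Real.log 2 := Real.log_pos (by norm_num)
  have hla : Real.log 2 ≤ Real.log a := Real.log_le_log (by norm_num) ha
  have ha0 : 0 < a := by linarith
  have hb0 : 0 < b := by linarith
  have h6 : Real.log (b / a) ≤ (b / a) ^ s / s := Real.log_le_rpow_div (by positivity) hs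
  have h7 : 1 ≤ (b / a) ^ s := Real.one_le_rpow (by rwa [one_le_div ha0]) hs.le
  rw [Real.log_div hb0.ne' ha0.ne'] at h6
  have h8 : 1 / s ≤ 1 / (s * Real.log 2) * Real.log a := by
    rw [one_div_mul_eq_div, div_le_div_iff₀ hs (by positivity)]
    nlinarith
  have h9 : (b / a) ^ s / s ≤ (b / a) ^ s * (1 / (s * Real.log 2) * Real.log a) := by
    rw [div_eq_mul_one_div]
    gcongr
  have h10 : Real.log a ≤ (b / a) ^ s * Real.log a := by nlinarith
  linarith

namespace DecayData

variable {τ σ q₀ : ℝ} {ψ χ : ℝ → ℝ}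

/-- Since `τ > 2`, eventually `q ^ (-(τ + 1)) ≤ ψ q < q ^ (-2)`. In particular `ψ` is positive at
large integers: where `ψ q = 0` the junk value of the quotient in the limit is `0`, which is not
close to `τ`. -/
theorem eventually_psi (h : DecayData τ σ q₀ ψ χ) :
    ∀ᶠ n : ℕ in atTop, 0 < ψ n ∧ ψ n * (n : ℝ) ^ 2 < 1 ∧ 1 ≤ ψ n * (n : ℝ) ^ (τ + 1) := by
  filter_upwards [Tendsto.eventually_const_lt h.two_lt h.tendsto,
    Tendsto.eventually_lt_const (lt_add_one τ) h.tendsto, eventually_ge_atTop 2] with n h1 h2 hn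
  have hn' : (2 : ℝ) ≤ n := by exact_mod_cast hn
  have hn0 : (0 : ℝ) < n := by linarith
  have hlog : 0 < Real.log n := Real.log_pos (by linarith)
  rw [lt_div_iff₀ hlog] at h1
  rw [div_lt_iff₀ hlog] at h2
  have hpos : 0 < ψ n := by
    refine lt_of_le_of_ne (h.nonneg n (by linarith)) fun h0 => ?_
    rw [← h0, Real.log_zero] at h1
    linarith
  refine ⟨hpos, ?_, ?_⟩
  · rw [← Real.log_neg_iff (by positivity), Real.log_mul hpos.ne' (by positivity), Real.log_pow]
    push_cast
    linarith
  · rw [← Real.log_nonneg_iff (by positivity), Real.log_mul hpos.ne' (by positivity),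
      Real.log_rpow hn0]
    linarith

theorem bddAbove (h : DecayData τ σ q₀ ψ χ) {t : ℝ} (ht : 0 < t) :
    BddAbove {q : ℝ | 1 ≤ q ∧ t ≤ ψ q} := by
  obtain ⟨n, ⟨h0, h1, -⟩, hn, hnt⟩ := (h.eventually_psi.and ((eventually_ge_atTop 1).and
    ((tendsto_natCast_atTop_atTop (R := ℝ)).eventually_ge_atTop (1 / t)))).exists
  have hn1 : (1 : ℝ) ≤ n := by exact_mod_cast hn
  rw [div_le_iff₀ ht] at hnt
  have hlt : ψ n < t := by
    have : ψ n * n ≤ ψ n * (n : ℝ) ^ 2 := by gcongr; nlinarith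
    by_contra! hc
    nlinarith
  refine ⟨n, fun q hq => ?_⟩
  by_contra! hc
  have := h.anti (show (n : ℝ) ∈ Set.Ici 1 from hn1) hq.1 hc.le
  linarith [hq.2]

theorem le_decreasingInverse (h : DecayData τ σ q₀ ψ χ) {q t : ℝ} (ht : 0 < t) (hq : 1 ≤ q)
    (hqt : t ≤ ψ q) : q ≤ decreasingInverse ψ t :=
  le_csSup (h.bddAbove ht) ⟨hq, hqt⟩

theorem decreasingInverse_mono (h : DecayData τ σ q₀ ψ χ) {s t : ℝ} (hs : 0 < s) (hst : s ≤ t) :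
    decreasingInverse ψ t ≤ decreasingInverse ψ s := by
  refine Real.sSup_le (fun q hq => ?_) (Real.sSup_nonneg fun q hq => by linarith [hq.1])
  exact h.le_decreasingInverse hs hq.1 (hst.trans hq.2)

theorem tendsto_decreasingInverse (h : DecayData τ σ q₀ ψ χ) :
    Tendsto (fun x => decreasingInverse ψ (1 / x)) atTop atTop := by
  rw [tendsto_atTop]
  intro b
  obtain ⟨n, ⟨h0, -, -⟩, hn, hnb⟩ := (h.eventually_psi.and ((eventually_ge_atTop 1).and
    ((tendsto_natCast_atTop_atTop (R := ℝ)).eventually_ge_atTop b))).exists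
  filter_upwards [eventually_ge_atTop (1 / ψ n), eventually_gt_atTop 0] with x hx hx0
  refine hnb.trans (h.le_decreasingInverse (by positivity) (by exact_mod_cast hn) ?_)
  rw [div_le_iff₀ h0] at hx
  rw [div_le_iff₀ hx0]
  linarith

theorem eventually_decreasingInverse_le (h : DecayData τ σ q₀ ψ χ) :
    ∀ᶠ x in atTop, decreasingInverse ψ (1 / x) ≤ 2 * √x := by
  have ht : Tendsto (fun x : ℝ => ⌊√x⌋₊ + 1) atTop atTop :=
    (tendsto_add_atTop_nat 1).comp (tendsto_nat_floor_atTop.comp Real.tendsto_sqrt_atTop)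
  filter_upwards [ht.eventually h.eventually_psi, eventually_ge_atTop 1] with x hx hx1
  obtain ⟨h0, h1, -⟩ := hx
  have hs1 : 1 ≤ √x := Real.one_le_sqrt.2 hx1
  have hn : √x < ((⌊√x⌋₊ + 1 : ℕ) : ℝ) := by exact_mod_cast Nat.lt_floor_add_one _
  have hn' : ((⌊√x⌋₊ + 1 : ℕ) : ℝ) ≤ √x + 1 := by
    push_cast
    linarith [Nat.floor_le (Real.sqrt_nonneg x)]
  generalize ((⌊√x⌋₊ + 1 : ℕ) : ℝ) = n at *
  refine (decreasingInverse_le h.anti (q := n) (by linarith) ?_).trans (by linarith)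
  rw [lt_div_iff₀ (by linarith)]
  have hxn : x ≤ n ^ 2 := by
    rw [← Real.sq_sqrt (show 0 ≤ x by linarith)]
    gcongr
  nlinarith

theorem eventually_log_le (h : DecayData τ σ q₀ ψ χ) :
    ∀ᶠ x in atTop, Real.log x ≤ 2 * (τ + 1) * Real.log (decreasingInverse ψ (1 / x)) := by
  have hD := h.tendsto_decreasingInverse
  have ht : Tendsto (fun x : ℝ => ⌊decreasingInverse ψ (1 / x)⌋₊ + 1) atTop atTop :=
    (tendsto_add_atTop_nat 1).comp (tendsto_nat_floor_atTop.comp hD)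
  filter_upwards [ht.eventually h.eventually_psi, hD.eventually_ge_atTop 2,
    eventually_ge_atTop 1] with x hx hx2 hx1
  set D := decreasingInverse ψ (1 / x)
  obtain ⟨h0, -, h1⟩ := hx
  have hn : D < ((⌊D⌋₊ + 1 : ℕ) : ℝ) := by exact_mod_cast Nat.lt_floor_add_one _
  have hn' : ((⌊D⌋₊ + 1 : ℕ) : ℝ) ≤ D + 1 := by
    push_cast
    linarith [Nat.floor_le (show 0 ≤ D by linarith)]
  generalize ((⌊D⌋₊ + 1 : ℕ) : ℝ) = n at *
  have hlt : ψ n < 1 / x := by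
    by_contra! hc
    have := h.le_decreasingInverse (by positivity) (by linarith) hc
    linarith
  have hτ := h.two_lt
  have hpow : 0 < n ^ (τ + 1) := Real.rpow_pos_of_pos (by linarith) _
  have hxn : x ≤ n ^ (τ + 1) := by
    rw [lt_div_iff₀ (by linarith)] at hlt
    by_contra! hc
    nlinarith
  calc Real.log x ≤ Real.log (n ^ (τ + 1)) := Real.log_le_log (by linarith) hxn
    _ = (τ + 1) * Real.log n := Real.log_rpow (by linarith) _
    _ ≤ (τ + 1) * Real.log (D ^ 2) := by
      have : n ≤ D ^ 2 := by nlinarith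
      have : 0 < n := by linarith
      gcongr
    _ = _ := by rw [Real.log_pow]; push_cast; ring

/-- The growth condition on `χ` with exponent `1`: `q χ(q)` increases and `χ(q) / q` decreases. -/
theorem exists_chi (h : DecayData τ σ q₀ ψ χ) : ∃ Q : ℝ, 1 ≤ Q ∧
    (∀ a, Q ≤ a → 1 ≤ χ a ∧ χ a ≤ Real.log a) ∧
    ∀ a b, Q ≤ a → a ≤ b → a * χ a ≤ b * χ b ∧ χ b * a ≤ χ a * b := by
  obtain ⟨Q, hQ⟩ := h.slow 1 one_pos
  refine ⟨max 1 (max q₀ Q), le_max_left _ _, fun a ha => h.chi a (by simp at ha; tauto), ?_⟩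
  intro a b ha hab
  simp only [max_le_iff] at ha
  obtain ⟨ha1, haq, haQ⟩ := ha
  rcases hab.eq_or_lt with rfl | hlt
  · exact ⟨le_rfl, le_rfl⟩
  have hb := (h.chi b (haq.trans hab)).1
  have ha' := (h.chi a haq).1
  have hmax : max (b / a) (a / b) = b / a := by
    refine max_eq_left ((div_le_one (by linarith)).2 hab |>.trans ?_)
    rwa [one_le_div (by linarith)]
  have h1 := hQ a b haQ (haQ.trans hab) hlt.ne
  have h2 := hQ b a (haQ.trans hab) haQ hlt.ne'
  rw [max_comm, hmax, Real.rpow_one, div_lt_div_iff₀ (by linarith) (by linarith)] at h2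
  rw [hmax, Real.rpow_one, div_lt_div_iff₀ (by linarith) (by linarith)] at h1
  constructor <;> linarith

/-- The decay condition on `ψ`, in product form and including the case of equal arguments. -/
theorem exists_ratio (h : DecayData τ σ q₀ ψ χ) : ∃ Q : ℕ, 1 ≤ Q ∧ (∀ n : ℕ, Q ≤ n → 0 < ψ n) ∧
    ∀ m n : ℕ, Q ≤ m → m ≤ n → ((n : ℝ) / m) ^ σ * ψ n ≤ ψ m := by
  obtain ⟨Q, hQ⟩ := h.ratio
  obtain ⟨Q', hQ'⟩ := eventually_atTop.1 h.eventually_psi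
  refine ⟨max 1 (max Q Q'), le_max_left _ _, fun n hn => (hQ' n (by simp at hn; tauto)).1, ?_⟩
  intro m n hm hmn
  simp only [max_le_iff] at hm
  obtain ⟨h1, h2, h3⟩ := hm
  rcases hmn.eq_or_lt with rfl | hlt
  · rw [div_self (by positivity), Real.one_rpow, one_mul]
  · have := hQ m n h2 hlt
    rwa [le_div_iff₀ (hQ' n (h3.trans hmn)).1] at this

theorem eventually_decayRate_pos (h : DecayData τ σ q₀ ψ χ) :
    ∀ᶠ x in atTop, 0 < decayRate ψ χ x := by
  obtain ⟨Q, hQ1, hQ, -⟩ := h.exists_chi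
  filter_upwards [h.tendsto_decreasingInverse.eventually_ge_atTop Q] with x hx
  have := (hQ _ hx).1
  unfold decayRate
  have : 0 < decreasingInverse ψ (1 / x) := by linarith
  positivity

/-- The rate is almost decreasing. From `E = ψ⁻¹(1 / y)` to `D = ψ⁻¹(1 / x)` with `x ≤ 2 * y` the
inverse grows at most by the factor `4`, because doubling the argument at least halves `ψ`. -/
theorem eventually_decayRate_le (h : DecayData τ σ q₀ ψ χ) :
    ∀ᶠ x in atTop, ∀ y, x / 2 ≤ y → decayRate ψ χ y ≤ 16 * decayRate ψ χ x := by
  obtain ⟨Q, hQ1, hQ, hmono⟩ := h.exists_chi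
  obtain ⟨Q', hQ'1, hQ'0, hratio⟩ := h.exists_ratio
  have hD := (h.tendsto_decreasingInverse.eventually_ge_atTop (max Q Q'))
  obtain ⟨X, hX⟩ := eventually_atTop.1 hD
  filter_upwards [eventually_ge_atTop (max 1 (2 * X)), hD] with x hx hDx y hxy
  simp only [max_le_iff] at hx
  have hDy := hX y (by linarith)
  have hyx : 0 < 1 / y := one_div_pos.2 (by linarith)
  unfold decayRate
  set D := decreasingInverse ψ (1 / x) with hDdef
  set E := decreasingInverse ψ (1 / y) with hEdef
  simp only [max_le_iff] at hDx hDy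
  have hDE : D ≤ 4 * E := by
    set n := ⌊E⌋₊ + 1 with hn
    have hEn : E < n := by rw [hn]; exact_mod_cast Nat.lt_floor_add_one _
    have hn' : (n : ℝ) ≤ E + 1 := by
      rw [hn]
      push_cast
      linarith [Nat.floor_le (show 0 ≤ E by linarith)]
    have hQn : Q' ≤ n := by
      have : (Q' : ℝ) < n := by linarith
      exact_mod_cast this.le
    have hlt : ψ n < 1 / y := by
      by_contra! hc
      have := h.le_decreasingInverse hyx (by linarith) hc
      linarith
    have hn0 : (0 : ℝ) < n := by linarith
    have h2 := hratio n (2 * n) hQn (by omega)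
    have h3 : (2 : ℝ) ≤ (((2 * n : ℕ) : ℝ) / n) ^ σ := by
      push_cast
      rw [mul_div_assoc, div_self hn0.ne', mul_one]
      conv_lhs => rw [← Real.rpow_one 2]
      exact Real.rpow_le_rpow_of_exponent_le (by norm_num) h.one_lt.le
    have h4 := hQ'0 (2 * n) (by omega)
    have h5 : ψ ((2 * n : ℕ) : ℝ) < 1 / x := by
      have h6 : 2 * ψ ((2 * n : ℕ) : ℝ) ≤ ψ n := (by gcongr : _ ≤ _).trans h2
      have h7 : 1 / y ≤ 2 / x := by
        rw [div_le_div_iff₀ (by linarith) (by linarith)]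
        linarith
      have h8 : 2 / x = 2 * (1 / x) := by ring
      linarith
    have h9 := decreasingInverse_le h.anti (q := ((2 * n : ℕ) : ℝ)) (by push_cast; linarith) h5
    push_cast at h9
    linarith
  have hχE := (hQ E hDy.1).1
  have hχD := (hQ D hDx.1).1
  have key : D * χ D ≤ 16 * (E * χ E) := by
    have hE0 : 0 < E := by linarith
    rcases le_total D E with hle | hle
    · have := (hmono D E hDx.1 hle).1
      nlinarith
    · have := (hmono E D hDy.1 hle).2
      have h1 : D * χ D * E ≤ (16 * (E * χ E)) * E := by
        calc D * χ D * E = D * (χ D * E) := by ring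
          _ ≤ D * (χ E * D) := by gcongr; linarith
          _ = χ E * (D * D) := by ring
          _ ≤ χ E * ((4 * E) * (4 * E)) := by gcongr; linarith
          _ = _ := by ring
      exact le_of_mul_le_mul_right h1 hE0
  have hD0 : 0 < D := by linarith
  have hE0 : 0 < E := by linarith
  rw [mul_one_div, div_le_div_iff₀ (by positivity) (by positivity)]
  linarith

/-- The rate decays no faster than a power of exponent below `3 / 4`; this makes it dominate the
tails of the lattice sums below. It follows from `D ≤ 2 √x` and `χ(D) ≤ log D`. -/
theorem exists_le_decayRate (h : DecayData τ σ q₀ ψ χ) :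
    ∃ c : ℝ, 0 < c ∧ ∀ᶠ x in atTop, c * x ^ (-(2 / 3) : ℝ) ≤ decayRate ψ χ x := by
  obtain ⟨Q, hQ1, hQ, -⟩ := h.exists_chi
  refine ⟨1 / (3 * 2 ^ (4 / 3 : ℝ)), by positivity, ?_⟩
  filter_upwards [h.tendsto_decreasingInverse.eventually_ge_atTop Q,
    h.eventually_decreasingInverse_le, eventually_gt_atTop 0] with x hx hx' hx0
  unfold decayRate
  set D := decreasingInverse ψ (1 / x)
  have hD0 : 0 < D := by linarith
  have hχ := hQ D hx
  have hχ0 : 0 < χ D := by linarith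
  rw [Real.rpow_neg hx0.le, ← one_div, one_div_mul_one_div]
  apply one_div_le_one_div_of_le (by positivity)
  have hlog : χ D ≤ D ^ (1 / 3 : ℝ) / (1 / 3) :=
    hχ.2.trans (Real.log_le_rpow_div hD0.le (by norm_num))
  calc D * χ D ≤ D * (D ^ (1 / 3 : ℝ) / (1 / 3)) := by gcongr
    _ = 3 * D ^ (4 / 3 : ℝ) := by
      rw [show (4 / 3 : ℝ) = 1 + 1 / 3 by norm_num, Real.rpow_add hD0, Real.rpow_one]
      ring
    _ ≤ 3 * (2 * √x) ^ (4 / 3 : ℝ) := by gcongr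
    _ = 3 * 2 ^ (4 / 3 : ℝ) * x ^ (2 / 3 : ℝ) := by
      rw [Real.mul_rpow (by norm_num) (by positivity), Real.sqrt_eq_rpow, ← Real.rpow_mul hx0.le]
      norm_num
      ring

/-- A single prime `q` contributes at most `decayRate ψ χ x * log q / log x`, up to a constant.
For `q` beyond `D = ψ⁻¹(1 / x)` this is the monotonicity of `q χ(q)`; for `q` below `D` the factor
`(1 + x ψ(q))⁻²` gains the power `(q / D) ^ (2 * σ)`, of which the power `2` pays for
`1 / (q χ(q))`, and the remaining positive power is dominated by `log q / log D`. -/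
theorem exists_prime_term_le (h : DecayData τ σ q₀ ψ χ) :
    ∃ C : ℝ, 0 < C ∧ ∃ N : ℕ, ∀ q : ℕ, N ≤ q → ∀ x : ℝ, q ≤ x →
      1 / (1 + x * ψ q) ^ 2 * (1 / (q * χ q)) ≤
        C * decayRate ψ χ x * (Real.log q / Real.log x) := by
  obtain ⟨Q, hQ1, hQ, hmono⟩ := h.exists_chi
  obtain ⟨Q', hQ'1, hQ'0, hratio⟩ := h.exists_ratio
  obtain ⟨X, hX⟩ := eventually_atTop.1 ((h.tendsto_decreasingInverse.eventually_ge_atTop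
    (max 2 Q)).and h.eventually_log_le)
  have hτ := h.two_lt
  have hσ := h.one_lt
  set s := 2 * σ - 2 with hs
  have hs0 : 0 < s := by linarith
  set A := 2 * (τ + 1) with hA
  have hA0 : 0 < A := by linarith
  have hl2 : 0 < Real.log 2 := Real.log_pos (by norm_num)
  set B := 1 + 1 / (s * Real.log 2) with hB
  have hB0 : 0 < B := by positivity
  refine ⟨A * (1 + 4 * 2 ^ s * B), by positivity, ⌈max 2 (max X (max Q Q'))⌉₊, ?_⟩
  intro q hq x hqx
  have hq' : max 2 (max X (max Q Q')) ≤ (q : ℝ) := Nat.ceil_le.1 hq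
  simp only [max_le_iff] at hq'
  obtain ⟨hq2, hqX, hqQ, hqQ'⟩ := hq'
  have hqQ'n : Q' ≤ q := by exact_mod_cast hqQ'
  obtain ⟨hD, hlog⟩ := hX x (by linarith)
  unfold decayRate
  set D := decreasingInverse ψ (1 / x)
  simp only [max_le_iff] at hD
  obtain ⟨hD2, hDQ⟩ := hD
  have hx0 : 0 < x := by linarith
  have hq0 : (0 : ℝ) < q := by linarith
  have hD0 : 0 < D := by linarith
  have hlx : 0 < Real.log x := Real.log_pos (by linarith)
  have hlD : 0 < Real.log D := Real.log_pos (by linarith)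
  have hlq : Real.log 2 ≤ Real.log q := Real.log_le_log (by norm_num) hq2
  have hψ : 0 < ψ q := hQ'0 q hqQ'n
  have hχq := (hQ q hqQ).1
  have hχD := (hQ D hDQ).1
  have hΘ : 0 < 1 / (D * χ D) := by positivity
  have hlA : Real.log q / Real.log D ≤ A * (Real.log q / Real.log x) := by
    rw [mul_div_assoc', div_le_div_iff₀ hlD hlx]
    nlinarith
  have hr0 : 0 ≤ Real.log q / Real.log x := by
    have : 0 < Real.log q := by linarith
    positivity
  rcases le_or_gt D q with hle | hlt
  · have h1 : 1 / (1 + x * ψ q) ^ 2 ≤ 1 := by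
      rw [div_le_one (by positivity)]
      exact one_le_pow₀ (by nlinarith)
    have h2 : 1 / (q * χ q) ≤ 1 / (D * χ D) :=
      one_div_le_one_div_of_le (by positivity) (hmono D q hDQ hle).1
    have h3 : 1 ≤ Real.log q / Real.log D := by
      rw [one_le_div hlD]
      exact Real.log_le_log hD0 hle
    calc 1 / (1 + x * ψ q) ^ 2 * (1 / (q * χ q)) ≤ 1 * (1 / (D * χ D)) := by gcongr
      _ = 1 / (D * χ D) * 1 := by ring
      _ ≤ 1 / (D * χ D) * (A * (Real.log q / Real.log x)) := by
        gcongr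
        exact h3.trans hlA
      _ = A * (1 + 0) * (1 / (D * χ D)) * (Real.log q / Real.log x) := by ring
      _ ≤ _ := by gcongr; positivity
  · have h1 : D / (2 * q) ≤ D / (2 * q) := le_rfl
    -- `n` is the largest integer below `D`, so that `ψ n ≥ 1 / x`
    obtain ⟨n, hqn, hnD, hDn⟩ : ∃ n : ℕ, q ≤ n ∧ (n : ℝ) < D ∧ D / 2 ≤ n := by
      refine ⟨⌈D⌉₊ - 1, ?_, ?_, ?_⟩
      · have := Nat.lt_ceil.2 hlt
        omega
      · exact Nat.lt_ceil.1 (by have := Nat.ceil_pos.2 hD0; omega)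
      · have h2 : 1 ≤ ⌈D⌉₊ := Nat.ceil_pos.2 hD0
        rw [Nat.cast_sub h2]
        have := Nat.le_ceil D
        push_cast
        linarith
    have hψn : 1 / x ≤ ψ n := le_of_lt_decreasingInverse h.anti (by linarith) hnD
    have hψn0 : 0 < ψ n := lt_of_lt_of_le (by positivity) hψn
    have h2 : (D / (2 * q)) ^ σ ≤ x * ψ q := by
      calc (D / (2 * q)) ^ σ ≤ ((n : ℝ) / q) ^ σ := by
            apply Real.rpow_le_rpow (by positivity) _ (by linarith)
            rw [div_le_div_iff₀ (by positivity) hq0]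
            nlinarith
        _ = x * (((n : ℝ) / q) ^ σ * (1 / x)) := by field_simp
        _ ≤ x * (((n : ℝ) / q) ^ σ * ψ n) := by gcongr
        _ ≤ x * ψ q := by gcongr; exact hratio q n hqQ'n hqn
    have h3 : (D / q) ^ 2 / 4 * ((D / q) ^ s / 2 ^ s) ≤ (1 + x * ψ q) ^ 2 := by
      calc (D / q) ^ 2 / 4 * ((D / q) ^ s / 2 ^ s)
          = (D / (2 * q)) ^ (2 : ℕ) * (D / (2 * q)) ^ s := by
            rw [show D / (2 * q) = D / q / 2 by ring,
              Real.div_rpow (x := D / q) (by positivity) (by norm_num)]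
            ring
        _ = ((D / (2 * q)) ^ σ) ^ 2 := by
          rw [← Real.rpow_natCast, ← Real.rpow_natCast, ← Real.rpow_add (by positivity),
            ← Real.rpow_mul (by positivity), hs]
          congr 1
          push_cast
          ring
        _ ≤ (1 + x * ψ q) ^ 2 := by gcongr; linarith
    have h4 : 1 / (q * χ q) ≤ (D / q) ^ 2 * (1 / (D * χ D)) := by
      have := (hmono q D hqQ hlt.le).2
      rw [div_pow, div_mul_div_comm, div_le_div_iff₀ (by positivity) (by positivity)]
      have : D * (χ D * q) * q ≤ D * (χ q * D) * q := by gcongr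
      linarith
    have hlq0 : 0 < Real.log q := by linarith
    have h5 : Real.log D / (B * Real.log q) ≤ (D / q) ^ s := by
      rw [div_le_iff₀ (by positivity)]
      exact log_le_rpow_mul_log hs0 hq2 hlt.le
    have h2s : (0 : ℝ) < 2 ^ s := by positivity
    have hDq : 0 < D / q := by positivity
    calc 1 / (1 + x * ψ q) ^ 2 * (1 / (q * χ q))
        ≤ 1 / ((D / q) ^ 2 / 4 * ((D / q) ^ s / 2 ^ s)) * ((D / q) ^ 2 * (1 / (D * χ D))) := by
          gcongr
      _ = 4 * 2 ^ s * (1 / (D * χ D)) * (1 / (D / q) ^ s) := by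
        have : (D / q) ^ s ≠ 0 := by positivity
        field_simp
      _ ≤ 4 * 2 ^ s * (1 / (D * χ D)) * (1 / (Real.log D / (B * Real.log q))) := by gcongr
      _ = 4 * 2 ^ s * B * (1 / (D * χ D)) * (Real.log q / Real.log D) := by field_simp
      _ ≤ 4 * 2 ^ s * B * (1 / (D * χ D)) * (A * (Real.log q / Real.log x)) := by gcongr
      _ = A * (0 + 4 * 2 ^ s * B) * (1 / (D * χ D)) * (Real.log q / Real.log x) := by ring
      _ ≤ _ := by gcongr; norm_num

/-- The sum over the prime divisors of `k` is controlled because `∑ log q ≤ log k`. -/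
theorem exists_sum_primes_le (h : DecayData τ σ q₀ ψ χ) :
    ∃ C : ℝ, 0 < C ∧ ∃ N : ℕ, ∀ P : Finset ℕ, (∀ q ∈ P, q.Prime ∧ N ≤ q) → ∀ k : ℕ, N ≤ k →
      ∑ q ∈ P with q ∣ k, 1 / (1 + k * ψ q) ^ 2 * (1 / (q * χ q)) ≤ C * decayRate ψ χ k := by
  obtain ⟨C, hC, N, hN⟩ := h.exists_prime_term_le
  obtain ⟨X, hX⟩ := eventually_atTop.1 h.eventually_decayRate_pos
  refine ⟨C, hC, max 2 (max N ⌈X⌉₊), fun P hP k hk => ?_⟩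
  simp only [max_le_iff] at hk hP
  have hk0 : (2 : ℝ) ≤ k := by exact_mod_cast hk.1
  have hΘ := hX k (Nat.ceil_le.1 hk.2.2)
  have hlk : 0 < Real.log k := Real.log_pos (by linarith)
  calc ∑ q ∈ P with q ∣ k, 1 / (1 + k * ψ q) ^ 2 * (1 / (q * χ q))
      ≤ ∑ q ∈ P with q ∣ k, C * decayRate ψ χ k * (Real.log q / Real.log k) := by
        refine Finset.sum_le_sum fun q hq => ?_
        rw [Finset.mem_filter] at hq
        exact hN q (hP q hq.1).2.2.1 k (by exact_mod_cast Nat.le_of_dvd (by omega) hq.2)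
    _ = C * decayRate ψ χ k * (Real.log ((∏ q ∈ P with q ∣ k, q : ℕ) : ℝ) / Real.log k) := by
        rw [← Finset.mul_sum, ← Finset.sum_div, Nat.cast_prod, Real.log_prod]
        intro q hq
        rw [Finset.mem_filter] at hq
        exact_mod_cast (hP q hq.1).1.ne_zero
    _ ≤ C * decayRate ψ χ k * 1 := by
        gcongr
        rw [div_le_one hlk]
        have hdvd : (∏ q ∈ P with q ∣ k, q) ∣ k := by
          refine Finset.prod_primes_dvd k (fun q hq => ?_) (fun q hq => ?_)
          · exact ((hP q (Finset.mem_filter.1 hq).1).1).prime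
          · exact (Finset.mem_filter.1 hq).2
        have hle := Nat.le_of_dvd (by omega) hdvd
        have hpos := Nat.pos_of_dvd_of_pos hdvd (by omega)
        exact Real.log_le_log (by exact_mod_cast hpos) (by exact_mod_cast hle)
    _ = _ := mul_one _

end DecayData

/-! ### Periodic multipliers concentrated near rational points -/

open scoped FourierTransform

theorem summable_one_div_one_add_mul_abs_sq {δ : ℝ} (hδ : 0 < δ) :
    Summable fun n : ℤ => 1 / (1 + δ * |(n : ℝ)|) ^ 2 := by
  have h1 : Summable fun n : ℤ => 1 / δ ^ 2 * (|(n : ℝ)| ^ (-2 : ℝ)) :=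
    (Real.summable_abs_int_rpow one_lt_two).mul_left _
  refine h1.of_norm_bounded_eventually ?_
  have : ∀ᶠ n : ℤ in cofinite, n ≠ 0 := (Set.finite_singleton 0).compl_mem_cofinite
  filter_upwards [this] with n hn
  have hn' : 0 < |(n : ℝ)| := by positivity
  rw [Real.norm_of_nonneg (by positivity), Real.rpow_neg hn'.le, ← one_div,
    show (2 : ℝ) = ((2 : ℕ) : ℝ) by norm_num, Real.rpow_natCast, one_div_mul_one_div, ← mul_pow]
  apply one_div_le_one_div_of_le (by positivity)
  gcongr
  linarith

section

open scoped ContDiff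

/-- A smooth probability density on `[-1, 1]` with quadratic Fourier decay. -/
theorem exists_bump : ∃ f : ℝ → ℝ, ContDiff ℝ ∞ f ∧ (∀ x, 0 ≤ f x) ∧ (∀ x, f x ≠ 0 → |x| ≤ 1) ∧
    ∫ x, f x = 1 ∧
    ∃ C, 0 < C ∧ ∀ ξ : ℝ, ‖𝓕 (fun x => (f x : ℂ)) ξ‖ ≤ C * (1 / (1 + |ξ|) ^ 2) := by
  let b : ContDiffBump (0 : ℝ) := ⟨1 / 2, 1, by norm_num, by norm_num⟩
  have hsupp : ∀ x, b.normed volume x ≠ 0 → |x| ≤ 1 := fun x hx => by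
    have : x ∈ Function.support (b.normed volume) := hx
    rw [b.support_normed_eq] at this
    simpa using (Metric.ball_subset_closedBall this)
  refine ⟨b.normed volume, b.contDiff_normed, b.nonneg_normed, hsupp, b.integral_normed, ?_⟩
  have hc : HasCompactSupport fun x => ((b.normed volume x : ℝ) : ℂ) :=
    b.hasCompactSupport_normed.comp_left (g := fun x : ℝ => (x : ℂ)) (by simp)
  have hd : ContDiff ℝ ∞ fun x => ((b.normed volume x : ℝ) : ℂ) :=
    Complex.ofRealCLM.contDiff.comp b.contDiff_normed
  let g : SchwartzMap ℝ ℂ := hc.toSchwartzMap hd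
  refine ⟨2 ^ 2 * ((Finset.Iic ((2, 0) : ℕ × ℕ)).sup fun m => SchwartzMap.seminorm ℝ m.1 m.2)
    (𝓕 g) + 1, by positivity, fun ξ => ?_⟩
  have := SchwartzMap.one_add_le_sup_seminorm_apply (𝕜 := ℝ) (m := (2, 0)) (k := 2) (n := 0)
    le_rfl le_rfl (𝓕 g) ξ
  rw [norm_iteratedFDeriv_zero, SchwartzMap.fourier_coe] at this
  change (1 + ‖ξ‖) ^ 2 * ‖𝓕 (fun x => ((b.normed volume x : ℝ) : ℂ)) ξ‖ ≤ _ at this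
  rw [Real.norm_eq_abs] at this
  rw [mul_one_div, le_div_iff₀ (by positivity), mul_comm]
  exact this.trans (le_add_of_nonneg_right zero_le_one)

theorem fourier_scale (f : ℝ → ℂ) {δ : ℝ} (hδ : 0 < δ) (w : ℝ) :
    𝓕 (fun x => ((1 / δ : ℝ) : ℂ) * f (x / δ)) w = 𝓕 f (w * δ) := by
  rw [Real.fourier_real_eq_integral_exp_smul, Real.fourier_real_eq_integral_exp_smul]
  have := Measure.integral_comp_div
    (fun x => Complex.exp (↑(-2 * Real.pi * x * (w * δ)) * Complex.I) • f x) δ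
  rw [abs_of_pos hδ] at this
  have h2 : ∀ x : ℝ, Complex.exp (↑(-2 * Real.pi * x * w) * Complex.I) •
      (((1 / δ : ℝ) : ℂ) * f (x / δ)) = ((1 / δ : ℝ) : ℂ) *
        (Complex.exp (↑(-2 * Real.pi * (x / δ) * (w * δ)) * Complex.I) • f (x / δ)) := fun x => by
    rw [show -2 * Real.pi * (x / δ) * (w * δ) = -2 * Real.pi * x * w by field_simp]
    simp only [smul_eq_mul]
    ring
  simp_rw [h2]
  rw [integral_const_mul, this, Complex.real_smul, ← mul_assoc, ← Complex.ofReal_mul]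
  rw [one_div_mul_cancel hδ.ne']
  simp

/-- Poisson summation for the bumps of width `δ` around the rational points with denominator `q`.
Only the frequencies divisible by `q` occur. -/
theorem hasSum_periodized_bump {f : ℝ → ℝ} (hf : ContDiff ℝ ∞ f) (hsupp : ∀ x, f x ≠ 0 → |x| ≤ 1)
    {C : ℝ} (hC : ∀ ξ : ℝ, ‖𝓕 (fun x => (f x : ℂ)) ξ‖ ≤ C * (1 / (1 + |ξ|) ^ 2))
    {q : ℕ} (hq : 0 < q) {δ : ℝ} (hδ : 0 < δ) (x : ℝ) :
    HasSum (fun k : ℤ => (if (q : ℤ) ∣ k then 𝓕 (fun x => (f x : ℂ)) (k * δ) else 0) *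
      Complex.exp (2 * Real.pi * Complex.I * k * x))
      ((∑' m : ℤ, 1 / (q * δ) * f ((q * x + m) / (q * δ)) : ℝ) : ℂ) := by
  have hq' : (0 : ℝ) < q := by exact_mod_cast hq
  have hqδ : 0 < q * δ := by positivity
  have hcs : HasCompactSupport fun y => ((1 / (q * δ) : ℝ) : ℂ) * (f (y / (q * δ)) : ℂ) := by
    refine HasCompactSupport.of_support_subset_isCompact
      (isCompact_Icc (a := -(q * δ)) (b := q * δ)) fun y hy => ?_
    have h1 : f (y / (q * δ)) ≠ 0 := fun h0 => hy (by simp [h0])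
    have h2 := hsupp _ h1
    rwa [abs_div, abs_of_pos hqδ, div_le_one hqδ, abs_le] at h2
  have hsm : ContDiff ℝ ∞ fun y => ((1 / (q * δ) : ℝ) : ℂ) * (f (y / (q * δ)) : ℂ) :=
    contDiff_const.mul (Complex.ofRealCLM.contDiff.comp (hf.comp (contDiff_id.div_const _)))
  have hF : ∀ n : ℤ, 𝓕 (fun y => ((1 / (q * δ) : ℝ) : ℂ) * (f (y / (q * δ)) : ℂ)) n =
      𝓕 (fun x => (f x : ℂ)) (n * (q * δ)) := fun n =>
    fourier_scale (fun x => (f x : ℂ)) hqδ n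
  have hP := SchwartzMap.tsum_eq_tsum_fourier (hcs.toSchwartzMap hsm) (q * x)
  rw [SchwartzMap.fourier_coe] at hP
  change ∑' m : ℤ, (((1 / (q * δ) : ℝ) : ℂ) * (f ((q * x + m) / (q * δ)) : ℂ)) =
    ∑' n : ℤ, 𝓕 (fun y => ((1 / (q * δ) : ℝ) : ℂ) * (f (y / (q * δ)) : ℂ)) n *
      fourier n ((q * x : ℝ) : UnitAddCircle) at hP
  simp_rw [hF, fourier_coe_apply] at hP
  have hsum : Summable fun n : ℤ => 𝓕 (fun x => (f x : ℂ)) (n * (q * δ)) *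
      Complex.exp (2 * Real.pi * Complex.I * n * ((q * x : ℝ) : ℂ) / ((1 : ℝ) : ℂ)) := by
    refine Summable.of_norm_bounded
      ((summable_one_div_one_add_mul_abs_sq hqδ).mul_left C) fun n => ?_
    have h1 : ‖Complex.exp (2 * Real.pi * Complex.I * n * ((q * x : ℝ) : ℂ) /
        ((1 : ℝ) : ℂ))‖ = 1 := by
      rw [show (2 * Real.pi * Complex.I * n * ((q * x : ℝ) : ℂ) / ((1 : ℝ) : ℂ) : ℂ) =
        ((2 * Real.pi * n * (q * x) : ℝ) : ℂ) * Complex.I by push_cast; ring]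
      exact Complex.norm_exp_ofReal_mul_I _
    rw [norm_mul, h1, mul_one]
    refine (hC _).trans_eq ?_
    rw [abs_mul, abs_of_pos hqδ, mul_comm |(n : ℝ)|]
  have hS := hsum.hasSum
  rw [← hP] at hS
  have hinj : Function.Injective fun n : ℤ => (q : ℤ) * n := fun a b hab =>
    mul_left_cancel₀ (by exact_mod_cast hq.ne') hab
  rw [← hinj.hasSum_iff]
  · convert hS using 1
    · ext n
      simp only [Function.comp_apply, dvd_mul_right, if_true]
      push_cast
      congr 2 <;> ring_nf
    · push_cast
      rfl
  · intro k hk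
    rw [if_neg, zero_mul]
    rintro ⟨n, rfl⟩
    exact hk ⟨n, rfl⟩

end

open scoped Pointwise in
theorem isClosed_near_rationals (q : ℕ) (hq : 0 < q) (r : ℝ) :
    IsClosed {x : ℝ | ∃ p : ℤ, |x - p / q| ≤ r} := by
  have hq' : (0 : ℝ) < q := by exact_mod_cast hq
  have h1 : IsClosed (Set.range ((↑) : ℤ → ℝ) + Metric.closedBall (0 : ℝ) (q * r)) :=
    Int.isClosedEmbedding_coe_real.isClosed_range.add_right_of_isCompact (isCompact_closedBall _ _)
  convert h1.preimage (continuous_const_mul (q : ℝ)) using 1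
  ext x
  simp only [Set.mem_preimage, Set.mem_add, Set.mem_range, Metric.mem_closedBall, dist_zero_right,
    Real.norm_eq_abs]
  have key : ∀ p : ℤ, |x - p / q| ≤ r ↔ |q * x - p| ≤ q * r := fun p => by
    rw [show (q : ℝ) * x - p = q * (x - p / q) by field_simp, abs_mul, abs_of_pos hq',
      mul_le_mul_iff_right₀ hq']
  constructor
  · rintro ⟨p, hp⟩
    exact ⟨p, ⟨p, rfl⟩, q * x - p, (key p).1 hp, by ring⟩
  · rintro ⟨_, ⟨p, rfl⟩, y, hy, hxy⟩
    refine ⟨p, (key p).2 ?_⟩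
    rwa [← hxy, add_sub_cancel_left]

theorem exists_finset_primes_of_not_summable {g : ℕ → ℝ} (hg : ¬ Summable fun p : Nat.Primes => g p)
    (N : ℕ) (hN : ∀ n, N ≤ n → 0 ≤ g n) :
    ∃ P : Finset ℕ, (∀ q ∈ P, q.Prime ∧ N ≤ q) ∧ 1 ≤ ∑ q ∈ P, g q := by
  by_contra! hcon
  refine hg ?_
  have h1 : Summable fun p : Nat.Primes => if N ≤ p then g p else 0 := by
    refine summable_of_sum_le (c := 1) (fun p => ?_) fun u => ?_
    · dsimp only
      split_ifs with h
      exacts [hN _ h, le_rfl]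
    · rw [← Finset.sum_filter]
      let e : Nat.Primes ↪ ℕ := ⟨fun p => (p : ℕ), Nat.Primes.coe_nat_injective⟩
      have := hcon (Finset.map e (u.filter fun p : Nat.Primes => N ≤ (p : ℕ))) ?_
      · rw [Finset.sum_map] at this
        exact this.le
      · intro q hq
        obtain ⟨p, hp, rfl⟩ := Finset.mem_map.1 hq
        exact ⟨p.2, (Finset.mem_filter.1 hp).2⟩
  refine h1.congr_cofinite ?_
  have hfin : {p : Nat.Primes | ¬ N ≤ (p : ℕ)}.Finite := by
    refine ((Set.finite_Iio N).preimage Nat.Primes.coe_nat_injective.injOn).subset fun p hp => ?_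
    simpa using! hp
  filter_upwards [hfin.compl_mem_cofinite] with p hp
  simp only [Set.mem_compl_iff, Set.mem_ofPred_eq, not_not] at hp
  rw [if_pos hp]

theorem norm_fourier_le_one {f : ℝ → ℝ} (h0 : ∀ x, 0 ≤ f x) (h1 : ∫ x, f x = 1) (ξ : ℝ) :
    ‖𝓕 (fun x => (f x : ℂ)) ξ‖ ≤ 1 := by
  rw [Real.fourier_real_eq_integral_exp_smul]
  refine (norm_integral_le_integral_norm _).trans_eq ?_
  rw [← h1]
  congr 1
  ext x
  rw [norm_smul, Complex.norm_exp_ofReal_mul_I, one_mul, Complex.norm_real,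
    Real.norm_of_nonneg (h0 x)]

theorem fourier_zero_eq {f : ℝ → ℝ} : 𝓕 (fun x => (f x : ℂ)) 0 = ((∫ x, f x : ℝ) : ℂ) := by
  rw [Real.fourier_real_eq_integral_exp_smul]
  simp [integral_complex_ofReal]

/-- A nonnegative `1`-periodic function `F` with mean `1` and absolutely convergent Fourier series,
concentrated on a closed set `S` of points that are `ψ`-approximable with a denominator `q ≥ N`.
Its Fourier coefficients vanish for `0 < |k| < N`, and are `O(decayRate ψ χ |k|)` for `|k| ≥ N`. -/
structure IsMultiplier (ψ χ : ℝ → ℝ) (C : ℝ) (N : ℕ) (F : ℝ → ℝ) (c : ℤ → ℂ) (S : Set ℝ) :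
    Prop where
  nonneg : ∀ x, 0 ≤ F x
  hasSum : ∀ x : ℝ, HasSum (fun k : ℤ => c k * Complex.exp (2 * Real.pi * Complex.I * k * x)) (F x)
  coeff_zero : c 0 = 1
  coeff_eq_zero : ∀ k, k ≠ 0 → k.natAbs < N → c k = 0
  norm_coeff_le_one : ∀ k, ‖c k‖ ≤ 1
  norm_coeff_le : ∀ k : ℤ, N ≤ k.natAbs → ‖c k‖ ≤ C * decayRate ψ χ |(k : ℝ)|
  exists_norm_coeff_le : ∃ C', 0 < C' ∧ ∀ k : ℤ, ‖c k‖ ≤ C' * (1 / (1 + |(k : ℝ)|) ^ 2)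
  isClosed : IsClosed S
  mem_of_ne_zero : ∀ x, F x ≠ 0 → x ∈ S
  approx : ∀ x ∈ S, ∃ q : ℕ, N ≤ q ∧ 0 < q ∧ ∃ p : ℤ, |x - p / q| ≤ ψ q

/-- The multipliers are averages of periodized bumps of width `ψ(q)`, over finitely many primes `q`
with weights proportional to `1 / (q χ(q))`. By divergence, the total weight before normalization
can be made at least `1`. -/
theorem DecayData.exists_isMultiplier {τ σ q₀ : ℝ} {ψ χ : ℝ → ℝ} (h : DecayData τ σ q₀ ψ χ)
    (hdiv : ¬ Summable fun p : Nat.Primes => 1 / (((p : ℕ) : ℝ) * χ ((p : ℕ) : ℝ))) :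
    ∃ C : ℝ, 0 < C ∧ ∀ᶠ N : ℕ in atTop, ∃ F c S, IsMultiplier ψ χ C N F c S := by
  obtain ⟨f, hf, hf0, hsupp, hint, C₁, hC₁, hfC⟩ := exists_bump
  obtain ⟨C₂, hC₂, N₂, hN₂⟩ := h.exists_sum_primes_le
  obtain ⟨Q, hQ1, hQ, -⟩ := h.exists_chi
  refine ⟨C₁ * C₂, by positivity, ?_⟩
  filter_upwards [eventually_ge_atTop N₂, eventually_ge_atTop 1, eventually_ge_atTop ⌈Q⌉₊,
    eventually_forall_ge_atTop.2 h.eventually_psi] with N hNN hN1 hNQ hψ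
  have hχ : ∀ n : ℕ, N ≤ n → 1 ≤ χ n := fun n hn => (hQ n (Nat.ceil_le.1 (hNQ.trans hn))).1
  obtain ⟨P, hP, hW⟩ := exists_finset_primes_of_not_summable (g := fun n => 1 / (n * χ n)) hdiv N
    fun n hn => by have := hχ n hn; positivity
  set W := ∑ q ∈ P, 1 / ((q : ℝ) * χ q) with hWdef
  have hW0 : 0 < W := by linarith
  set w : ℕ → ℝ := fun q => 1 / ((q : ℝ) * χ q) / W with hw
  have hw0 : ∀ q ∈ P, 0 ≤ w q := fun q hq => by
    have := hχ q (hP q hq).2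
    positivity
  have hw1 : ∀ q ∈ P, w q ≤ 1 / ((q : ℝ) * χ q) := fun q hq => by
    have := hχ q (hP q hq).2
    exact div_le_self (by positivity) hW
  have hwsum : ∑ q ∈ P, w q = 1 := by
    rw [hw, ← Finset.sum_div, ← hWdef, div_self hW0.ne']
  have hpos : ∀ q ∈ P, 0 < q := fun q hq => (hP q hq).1.pos
  have hψ0 : ∀ q ∈ P, 0 < ψ q := fun q hq => (hψ q (hP q hq).2).1
  set g := 𝓕 (fun x => (f x : ℂ)) with hg
  have hg1 : ∀ ξ, ‖g ξ‖ ≤ 1 := norm_fourier_le_one hf0 hint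
  set c : ℤ → ℂ := fun k => ∑ q ∈ P, (w q : ℂ) * (if (q : ℤ) ∣ k then g (k * ψ q) else 0) with hc
  set F : ℝ → ℝ := fun x => ∑ q ∈ P, w q *
    ∑' m : ℤ, 1 / (q * ψ q) * f ((q * x + m) / (q * ψ q)) with hF
  have hcterm : ∀ q ∈ P, ∀ k : ℤ, ‖(w q : ℂ) * (if (q : ℤ) ∣ k then g (k * ψ q) else 0)‖ ≤
      w q * (C₁ * (1 / (1 + |(k : ℝ)| * ψ q) ^ 2)) := by
    intro q hq k
    have hq0 := hψ0 q hq
    rw [norm_mul, Complex.norm_real, Real.norm_of_nonneg (hw0 q hq)]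
    refine mul_le_mul_of_nonneg_left ?_ (hw0 q hq)
    split_ifs with hd
    · have := hfC (k * ψ q)
      rwa [abs_mul, abs_of_pos hq0] at this
    · rw [norm_zero]
      positivity
  refine ⟨F, c, ⋃ q ∈ P, {x : ℝ | ∃ p : ℤ, |x - p / q| ≤ ψ q}, ?_⟩
  constructor
  · intro x
    refine Finset.sum_nonneg fun q hq => mul_nonneg (hw0 q hq) (tsum_nonneg fun m => ?_)
    have := hψ0 q hq
    have := hf0 ((q * x + m) / (q * ψ q))
    positivity
  · intro x
    simp only [hF, hc, Finset.sum_mul, Complex.ofReal_sum]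
    refine hasSum_sum fun q hq => ?_
    have := (hasSum_periodized_bump hf hsupp hfC (hpos q hq) (hψ0 q hq) x).mul_left (w q : ℂ)
    simpa only [Complex.ofReal_mul, mul_assoc] using this
  · have : g 0 = 1 := by rw [hg, fourier_zero_eq, hint]; simp
    simp only [hc, dvd_zero, if_true, Int.cast_zero, zero_mul, this, mul_one]
    rw [← Complex.ofReal_sum, hwsum, Complex.ofReal_one]
  · intro k hk hkN
    refine Finset.sum_eq_zero fun q hq => ?_
    rw [if_neg, mul_zero]
    intro hd
    have h1 := Nat.le_of_dvd (Int.natAbs_pos.2 hk) (Int.natCast_dvd.1 hd)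
    have h2 := (hP q hq).2
    omega
  · intro k
    refine (norm_sum_le _ _).trans (le_of_le_of_eq (Finset.sum_le_sum fun q hq => ?_) hwsum)
    rw [norm_mul, Complex.norm_real, Real.norm_of_nonneg (hw0 q hq)]
    refine mul_le_of_le_one_right (hw0 q hq) ?_
    split_ifs
    exacts [hg1 _, by simp]
  · intro k hk
    have habs : |(k : ℝ)| = (k.natAbs : ℝ) := by
      rw [Nat.cast_natAbs, Int.cast_abs]
    have := hN₂ P (fun q hq => ⟨(hP q hq).1, hNN.trans (hP q hq).2⟩) k.natAbs (hNN.trans hk)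
    calc ‖c k‖ ≤ ∑ q ∈ P, ‖(w q : ℂ) * (if (q : ℤ) ∣ k then g (k * ψ q) else 0)‖ := norm_sum_le _ _
      _ = ∑ q ∈ P with q ∣ k.natAbs,
          ‖(w q : ℂ) * (if (q : ℤ) ∣ k then g (k * ψ q) else 0)‖ := by
        rw [Finset.sum_filter]
        refine Finset.sum_congr rfl fun q _ => ?_
        by_cases hd : (q : ℤ) ∣ k
        · rw [if_pos (Int.natCast_dvd.1 hd)]
        · rw [if_neg hd, if_neg (fun h' => hd (Int.natCast_dvd.2 h')), mul_zero, norm_zero]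
      _ ≤ ∑ q ∈ P with q ∣ k.natAbs, C₁ * (1 / (1 + k.natAbs * ψ q) ^ 2 * (1 / (q * χ q))) := by
        refine Finset.sum_le_sum fun q hq => ?_
        have hq' := (Finset.mem_filter.1 hq).1
        have h1 := hψ0 q hq'
        refine (hcterm q hq' k).trans ?_
        rw [habs]
        calc w q * (C₁ * (1 / (1 + k.natAbs * ψ q) ^ 2))
            ≤ 1 / ((q : ℝ) * χ q) * (C₁ * (1 / (1 + k.natAbs * ψ q) ^ 2)) := by
              gcongr
              exact hw1 q hq'
          _ = _ := by ring
      _ = C₁ * ∑ q ∈ P with q ∣ k.natAbs, 1 / (1 + k.natAbs * ψ q) ^ 2 * (1 / (q * χ q)) :=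
        (Finset.mul_sum _ _ _).symm
      _ ≤ C₁ * (C₂ * decayRate ψ χ k.natAbs) := by gcongr
      _ = _ := by rw [habs, mul_assoc]
  · refine ⟨(∑ q ∈ P, w q * (C₁ * (1 / (min 1 (ψ q)) ^ 2))) + 1, ?_, fun k => ?_⟩
    · have : 0 ≤ ∑ q ∈ P, w q * (C₁ * (1 / (min 1 (ψ q)) ^ 2)) :=
        Finset.sum_nonneg fun q hq => mul_nonneg (hw0 q hq) (by positivity)
      linarith
    · rw [add_mul, Finset.sum_mul]
      refine le_add_of_le_of_nonneg ((norm_sum_le _ _).trans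
        (Finset.sum_le_sum fun q hq => (hcterm q hq k).trans ?_)) (by positivity)
      have h1 := hψ0 q hq
      have h2 := hw0 q hq
      rw [mul_assoc, mul_assoc, one_div_mul_one_div, ← mul_pow]
      have h3 : min 1 (ψ q) * (1 + |(k : ℝ)|) ≤ 1 + |(k : ℝ)| * ψ q := by
        have h4 : min 1 (ψ q) ≤ 1 := min_le_left _ _
        have h5 : min 1 (ψ q) * |(k : ℝ)| ≤ ψ q * |(k : ℝ)| := by
          gcongr
          exact min_le_right _ _
        linarith
      have h6 : 0 < min 1 (ψ q) := lt_min one_pos h1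
      gcongr
  · exact isClosed_biUnion_finset fun q hq => isClosed_near_rationals q (hpos q hq) _
  · intro x hx
    by_contra hcon
    refine hx (Finset.sum_eq_zero fun q hq => ?_)
    have hq0 : (0 : ℝ) < q := by exact_mod_cast hpos q hq
    have h1 := hψ0 q hq
    refine mul_eq_zero_of_right _ ?_
    convert tsum_zero with m
    refine mul_eq_zero_of_right _ ?_
    by_contra hne
    refine hcon (Set.mem_biUnion hq ⟨-m, ?_⟩)
    have h2 := hsupp _ hne
    rw [abs_div, abs_of_pos (by positivity : 0 < q * ψ q), div_le_one (by positivity)] at h2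
    rw [show (q : ℝ) * x + m = q * (x - ((-m : ℤ) : ℝ) / q) by push_cast; field_simp; ring,
      abs_mul, abs_of_pos hq0] at h2
    exact le_of_mul_le_mul_left h2 hq0
  · intro x hx
    obtain ⟨q, hq, p, hp⟩ := Set.mem_iUnion₂.1 hx
    exact ⟨q, (hP q hq).2, hpos q hq, p, hp⟩

/-! ### Multiplying a density by a multiplier -/

/-- Continuous nonnegative functions supported in `[-1, 1]` with quadratic Fourier decay. -/
structure IsDecayingDensity (G : ℝ → ℝ) : Prop where
  continuous : Continuous G
  nonneg : ∀ x, 0 ≤ G x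
  abs_le_one : ∀ x, G x ≠ 0 → |x| ≤ 1
  decay : ∃ C, 0 < C ∧ ∀ ξ : ℝ, ‖𝓕 (fun x => (G x : ℂ)) ξ‖ ≤ C * (1 / (1 + |ξ|) ^ 2)

theorem IsDecayingDensity.hasCompactSupport {G : ℝ → ℝ} (hG : IsDecayingDensity G) :
    HasCompactSupport G :=
  HasCompactSupport.of_support_subset_isCompact (isCompact_Icc (a := -1) (b := 1))
    fun x hx => abs_le.1 (hG.abs_le_one x hx)

theorem IsDecayingDensity.integrable {G : ℝ → ℝ} (hG : IsDecayingDensity G) : Integrable G :=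
  hG.continuous.integrable_of_hasCompactSupport hG.hasCompactSupport

theorem exists_isDecayingDensity : ∃ G : ℝ → ℝ, IsDecayingDensity G ∧ ∫ x, G x = 1 := by
  obtain ⟨f, hf, hf0, hsupp, hint, hC⟩ := exists_bump
  exact ⟨f, ⟨hf.continuous, hf0, hsupp, hC⟩, hint⟩

/-- The exponent `5 / 4` leaves `3 / 4` of the exponent `2` for pointwise gains, see
`one_div_sq_eq_rpow`. -/
theorem exists_tsum_lattice_le : ∃ S : ℝ, 0 < S ∧ ∀ ξ : ℝ,
    Summable (fun k : ℤ => (1 + |ξ - k|) ^ (-(5 / 4) : ℝ)) ∧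
    ∑' k : ℤ, (1 + |ξ - k|) ^ (-(5 / 4) : ℝ) ≤ S := by
  have h1 : Summable fun n : ℤ => (1 + |(n : ℝ)|) ^ (-(5 / 4) : ℝ) := by
    refine (Real.summable_abs_int_rpow (b := 5 / 4) (by norm_num)).of_norm_bounded_eventually ?_
    have : ∀ᶠ n : ℤ in cofinite, n ≠ 0 := (Set.finite_singleton 0).compl_mem_cofinite
    filter_upwards [this] with n hn
    have hn' : 0 < |(n : ℝ)| := by positivity
    rw [Real.norm_of_nonneg (by positivity)]
    exact Real.rpow_le_rpow_of_nonpos hn' (by linarith) (by norm_num)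
  have h0 : 0 ≤ ∑' n : ℤ, (1 + |(n : ℝ)|) ^ (-(5 / 4) : ℝ) := tsum_nonneg fun n => by positivity
  refine ⟨2 ^ (5 / 4 : ℝ) * ∑' n : ℤ, (1 + |(n : ℝ)|) ^ (-(5 / 4) : ℝ) + 1, by positivity,
    fun ξ => ?_⟩
  have h2 : Summable fun k : ℤ => 2 ^ (5 / 4 : ℝ) * (1 + |((⌊ξ⌋ - k : ℤ) : ℝ)|) ^ (-(5 / 4) : ℝ) :=
    (((Equiv.subLeft ⌊ξ⌋).summable_iff).2 h1).mul_left _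
  have h3 : ∀ k : ℤ, (1 + |ξ - k|) ^ (-(5 / 4) : ℝ) ≤
      2 ^ (5 / 4 : ℝ) * (1 + |((⌊ξ⌋ - k : ℤ) : ℝ)|) ^ (-(5 / 4) : ℝ) := fun k => by
    have h4 : (1 + |((⌊ξ⌋ - k : ℤ) : ℝ)|) / 2 ≤ 1 + |ξ - k| := by
      have h5 : |((⌊ξ⌋ - k : ℤ) : ℝ)| ≤ |ξ - k| + 1 := by
        push_cast
        have h6 := Int.floor_le ξ
        have h7 := Int.lt_floor_add_one ξ
        rw [show (⌊ξ⌋ : ℝ) - k = (ξ - k) + (⌊ξ⌋ - ξ) by ring]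
        refine (abs_add_le _ _).trans ?_
        gcongr
        rw [abs_le]
        constructor <;> linarith
      have := abs_nonneg (ξ - k)
      linarith
    refine (Real.rpow_le_rpow_of_nonpos (by positivity) h4 (by norm_num)).trans_eq ?_
    rw [Real.div_rpow (by positivity) (by norm_num), Real.rpow_neg (by norm_num : (0 : ℝ) ≤ 2)]
    field_simp
  have h4 : Summable fun k : ℤ => (1 + |ξ - k|) ^ (-(5 / 4) : ℝ) :=
    Summable.of_nonneg_of_le (fun k => by positivity) h3 h2
  refine ⟨h4, (h4.tsum_le_tsum h3 h2).trans ?_⟩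
  have h5 := (Equiv.subLeft ⌊ξ⌋).tsum_eq fun n : ℤ => (1 + |(n : ℝ)|) ^ (-(5 / 4) : ℝ)
  simp only [Equiv.subLeft_apply] at h5
  rw [tsum_mul_left, h5]
  linarith

theorem one_div_sq_eq_rpow {t : ℝ} (ht : 0 < t) :
    1 / t ^ 2 = t ^ (-(3 / 4) : ℝ) * t ^ (-(5 / 4) : ℝ) := by
  rw [← Real.rpow_add ht, one_div, ← Real.rpow_natCast, ← Real.rpow_neg ht.le]
  norm_num

theorem one_div_sq_le_rpow {t : ℝ} (ht : 1 ≤ t) : 1 / t ^ 2 ≤ t ^ (-(5 / 4) : ℝ) := by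
  rw [one_div_sq_eq_rpow (by linarith)]
  exact mul_le_of_le_one_left (by positivity)
    (Real.rpow_le_one_of_one_le_of_nonpos ht (by norm_num))

namespace IsMultiplier

variable {ψ χ F G : ℝ → ℝ} {C : ℝ} {N : ℕ} {c : ℤ → ℂ} {S : Set ℝ}

theorem summable_norm (hF : IsMultiplier ψ χ C N F c S) : Summable fun k => ‖c k‖ := by
  obtain ⟨C', -, hC'⟩ := hF.exists_norm_coeff_le
  have := (summable_one_div_one_add_mul_abs_sq one_pos).mul_left C'
  simp only [one_mul] at this
  exact Summable.of_nonneg_of_le (fun k => norm_nonneg _) hC' this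

theorem norm_exp_eq_one (k : ℤ) (x : ℝ) : ‖Complex.exp (2 * Real.pi * Complex.I * k * x)‖ = 1 := by
  rw [show (2 * Real.pi * Complex.I * k * x : ℂ) = ((2 * Real.pi * k * x : ℝ) : ℂ) * Complex.I by
    push_cast; ring]
  exact Complex.norm_exp_ofReal_mul_I _

theorem continuous (hF : IsMultiplier ψ χ C N F c S) : Continuous F := by
  have h1 : Continuous fun x : ℝ =>
      ∑' k : ℤ, c k * Complex.exp (2 * Real.pi * Complex.I * k * x) := by
    refine continuous_tsum (fun k => by fun_prop) hF.summable_norm fun k x => ?_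
    rw [norm_mul, norm_exp_eq_one, mul_one]
  have h2 : F = fun x : ℝ =>
      (∑' k : ℤ, c k * Complex.exp (2 * Real.pi * Complex.I * k * x)).re := by
    ext x
    rw [(hF.hasSum x).tsum_eq, Complex.ofReal_re]
  rw [h2]
  exact Complex.continuous_re.comp h1

/-- Multiplication by a multiplier convolves the Fourier transform with the coefficients. -/
theorem hasSum_fourier (hF : IsMultiplier ψ χ C N F c S) (hG : IsDecayingDensity G) (ξ : ℝ) :
    HasSum (fun k : ℤ => c k * 𝓕 (fun x => (G x : ℂ)) (ξ - k))
      (𝓕 (fun x => ((G x * F x : ℝ) : ℂ)) ξ) := by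
  simp only [Real.fourier_real_eq_integral_exp_smul, smul_eq_mul]
  have hterm : ∀ (k : ℤ) (x : ℝ),
      c k * (Complex.exp (↑(-2 * Real.pi * x * (ξ - k)) * Complex.I) * (G x : ℂ)) =
      (Complex.exp (↑(-2 * Real.pi * x * ξ) * Complex.I) * (G x : ℂ)) *
        (c k * Complex.exp (2 * Real.pi * Complex.I * k * x)) := fun k x => by
    rw [show (↑(-2 * Real.pi * x * (ξ - k)) * Complex.I : ℂ) =
      ↑(-2 * Real.pi * x * ξ) * Complex.I + 2 * Real.pi * Complex.I * k * x by push_cast; ring,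
      Complex.exp_add]
    ring
  have hnorm : ∀ (k : ℤ) (x : ℝ),
      ‖c k * (Complex.exp (↑(-2 * Real.pi * x * (ξ - k)) * Complex.I) * (G x : ℂ))‖ =
        ‖c k‖ * ‖G x‖ := fun k x => by
    rw [norm_mul, norm_mul, Complex.norm_exp_ofReal_mul_I, one_mul, Complex.norm_real]
  have key := hasSum_integral_of_summable_integral_norm (μ := volume)
    (F := fun (k : ℤ) (x : ℝ) =>
      c k * (Complex.exp (↑(-2 * Real.pi * x * (ξ - k)) * Complex.I) * (G x : ℂ))) ?_ ?_
  · simp only [integral_const_mul] at key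
    have hint : ∫ x : ℝ, Complex.exp (↑(-2 * Real.pi * x * ξ) * Complex.I) *
        ((G x * F x : ℝ) : ℂ) = ∫ x : ℝ, ∑' k : ℤ,
          c k * (Complex.exp (↑(-2 * Real.pi * x * (ξ - k)) * Complex.I) * (G x : ℂ)) := by
      refine integral_congr_ae (Eventually.of_forall fun x => ?_)
      dsimp only
      rw [tsum_congr fun k => hterm k x, tsum_mul_left, (hF.hasSum x).tsum_eq]
      push_cast
      ring
    rw [hint]
    exact key
  · intro k
    refine (hG.integrable.norm.const_mul ‖c k‖).mono' ?_ ?_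
    · refine Continuous.aestronglyMeasurable ?_
      have := hG.continuous
      fun_prop
    · exact Eventually.of_forall fun x => (hnorm k x).le
  · simp only [hnorm, integral_const_mul]
    exact hF.summable_norm.mul_right _

theorem isDecayingDensity_mul (hF : IsMultiplier ψ χ C N F c S) (hG : IsDecayingDensity G) :
    IsDecayingDensity fun x => G x * F x := by
  refine ⟨hG.continuous.mul hF.continuous, fun x => mul_nonneg (hG.nonneg x) (hF.nonneg x),
    fun x hx => hG.abs_le_one x (left_ne_zero_of_mul hx), ?_⟩
  obtain ⟨C₁, hC₁, h1⟩ := hG.decay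
  obtain ⟨C₂, hC₂, h2⟩ := hF.exists_norm_coeff_le
  obtain ⟨T, hT, hlat⟩ := exists_tsum_lattice_le
  refine ⟨C₂ * C₁ * 2 * (2 * T), by positivity, fun ξ => ?_⟩
  set A := C₂ * C₁ * 2 * (1 / (1 + |ξ|) ^ 2) with hA
  have hA0 : 0 ≤ A := by positivity
  have hbd : ∀ k : ℤ, ‖c k * 𝓕 (fun x => (G x : ℂ)) (ξ - k)‖ ≤
      A * ((1 + |(0 : ℝ) - k|) ^ (-(5 / 4) : ℝ) + (1 + |ξ - k|) ^ (-(5 / 4) : ℝ)) := fun k => by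
    have h3 : (1 + |ξ|) ^ 2 ≤ 2 * ((1 + |(k : ℝ)|) ^ 2 + (1 + |ξ - k|) ^ 2) := by
      have : |ξ| ≤ |(k : ℝ)| + |ξ - k| := by
        have := abs_add_le (k : ℝ) (ξ - k)
        rwa [add_sub_cancel] at this
      have h4 : (1 + |ξ|) ^ 2 ≤ ((1 + |(k : ℝ)|) + (1 + |ξ - k|)) ^ 2 := by
        have := abs_nonneg ξ
        gcongr ?_ ^ 2
        linarith
      nlinarith [sq_nonneg ((1 + |(k : ℝ)|) - (1 + |ξ - k|))]
    have h5 : 1 / (1 + |(k : ℝ)|) ^ 2 * (1 / (1 + |ξ - k|) ^ 2) ≤ 2 * (1 / (1 + |ξ|) ^ 2) *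
        (1 / (1 + |(k : ℝ)|) ^ 2 + 1 / (1 + |ξ - k|) ^ 2) := by
      have ha : 0 < (1 + |ξ|) ^ 2 := by positivity
      have hb : 0 < (1 + |(k : ℝ)|) ^ 2 := by positivity
      have hc : 0 < (1 + |ξ - k|) ^ 2 := by positivity
      rw [div_add_div _ _ hb.ne' hc.ne', one_div_mul_one_div, mul_one_div, div_mul_div_comm,
        div_le_div_iff₀ (by positivity) (by positivity), one_mul, one_mul, mul_one]
      have := mul_le_mul_of_nonneg_right h3 (mul_pos hb hc).le
      linarith
    rw [norm_mul, zero_sub, abs_neg]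
    calc ‖c k‖ * ‖𝓕 (fun x => (G x : ℂ)) (ξ - k)‖
        ≤ (C₂ * (1 / (1 + |(k : ℝ)|) ^ 2)) * (C₁ * (1 / (1 + |ξ - k|) ^ 2)) := by
          gcongr
          exacts [h2 k, h1 _]
      _ = C₂ * C₁ * (1 / (1 + |(k : ℝ)|) ^ 2 * (1 / (1 + |ξ - k|) ^ 2)) := by ring
      _ ≤ C₂ * C₁ * (2 * (1 / (1 + |ξ|) ^ 2) *
          (1 / (1 + |(k : ℝ)|) ^ 2 + 1 / (1 + |ξ - k|) ^ 2)) := by gcongr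
      _ = A * (1 / (1 + |(k : ℝ)|) ^ 2 + 1 / (1 + |ξ - k|) ^ 2) := by rw [hA]; ring
      _ ≤ _ := by
        gcongr
        · exact one_div_sq_le_rpow (by linarith [abs_nonneg (k : ℝ)])
        · exact one_div_sq_le_rpow (by linarith [abs_nonneg (ξ - k)])
  have hs := ((hlat 0).1.add (hlat ξ).1).mul_left A
  rw [← (hF.hasSum_fourier hG ξ).tsum_eq]
  calc _ ≤ ∑' k : ℤ, A * ((1 + |(0 : ℝ) - k|) ^ (-(5 / 4) : ℝ) + (1 + |ξ - k|) ^ (-(5 / 4) : ℝ)) :=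
        tsum_of_norm_bounded hs.hasSum hbd
    _ = A * (∑' k : ℤ, (1 + |(0 : ℝ) - k|) ^ (-(5 / 4) : ℝ) +
        ∑' k : ℤ, (1 + |ξ - k|) ^ (-(5 / 4) : ℝ)) := by
      rw [tsum_mul_left, (hlat 0).1.tsum_add (hlat ξ).1]
    _ ≤ A * (T + T) := by
      gcongr
      exacts [(hlat 0).2, (hlat ξ).2]
    _ = _ := by rw [hA]; ring

/-- The term `k = 0` cancels against `𝓕 G ξ`, so that only the terms with `|k| ≥ N` remain. -/
theorem norm_fourier_mul_sub_le (hF : IsMultiplier ψ χ C N F c S) (hG : IsDecayingDensity G)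
    {C₁ T ξ B : ℝ} (hC₁ : ∀ ξ : ℝ, ‖𝓕 (fun x => (G x : ℂ)) ξ‖ ≤ C₁ * (1 / (1 + |ξ|) ^ 2))
    (hs : Summable (fun k : ℤ => (1 + |ξ - k|) ^ (-(5 / 4) : ℝ)))
    (hT : ∑' k : ℤ, (1 + |ξ - k|) ^ (-(5 / 4) : ℝ) ≤ T) (hB : 0 ≤ B)
    (hbd : ∀ k : ℤ, N ≤ k.natAbs → ‖c k‖ * (C₁ * (1 + |ξ - k|) ^ (-(3 / 4) : ℝ)) ≤ B) :
    ‖𝓕 (fun x => ((G x * F x : ℝ) : ℂ)) ξ - 𝓕 (fun x => (G x : ℂ)) ξ‖ ≤ B * T := by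
  have h1 := (hF.hasSum_fourier hG ξ).sub
    (hasSum_ite_eq (0 : ℤ) (𝓕 (fun x => (G x : ℂ)) ξ))
  rw [← h1.tsum_eq]
  refine (tsum_of_norm_bounded (hs.mul_left B).hasSum fun k => ?_).trans ?_
  · by_cases hk : k = 0
    · subst hk
      simp only [hF.coeff_zero, Int.cast_zero, sub_zero, one_mul, if_true, sub_self, norm_zero]
      positivity
    rw [if_neg hk, sub_zero]
    rcases lt_or_ge k.natAbs N with hkN | hkN
    · rw [hF.coeff_eq_zero k hk hkN, zero_mul, norm_zero]
      positivity
    rw [norm_mul]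
    calc ‖c k‖ * ‖𝓕 (fun x => (G x : ℂ)) (ξ - k)‖
        ≤ ‖c k‖ * (C₁ * (1 / (1 + |ξ - k|) ^ 2)) := by gcongr; exact hC₁ _
      _ = ‖c k‖ * (C₁ * (1 + |ξ - k|) ^ (-(3 / 4) : ℝ)) * (1 + |ξ - k|) ^ (-(5 / 4) : ℝ) := by
        rw [one_div_sq_eq_rpow (by positivity)]
        ring
      _ ≤ _ := by gcongr; exact hbd k hkN
  · rw [tsum_mul_left]
    gcongr

end IsMultiplier

theorem rpow_neg_three_quarters_half_le {t s : ℝ} (ht : 0 < t) (hs : t / 2 ≤ s) :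
    (1 + s) ^ (-(3 / 4) : ℝ) ≤ 2 * t ^ (-(3 / 4) : ℝ) := by
  calc (1 + s) ^ (-(3 / 4) : ℝ) ≤ (t / 2) ^ (-(3 / 4) : ℝ) :=
        Real.rpow_le_rpow_of_nonpos (by positivity) (by linarith) (by norm_num)
    _ = 2 ^ (3 / 4 : ℝ) * t ^ (-(3 / 4) : ℝ) := by
      rw [Real.div_rpow ht.le (by norm_num), Real.rpow_neg (by norm_num : (0 : ℝ) ≤ 2)]
      field_simp
    _ ≤ 2 ^ (1 : ℝ) * t ^ (-(3 / 4) : ℝ) := by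
      gcongr <;> norm_num
    _ = _ := by rw [Real.rpow_one]

/-- One step of the construction. The factor `ω` absorbs the constants for `|ξ| ≥ N / 2`; for
smaller `|ξ|` only frequencies at distance at least `N / 2` matter, and the change is
`O(N ^ (-3/4))`, which beats `decayRate`. -/
theorem DecayData.exists_mul_isDecayingDensity {τ σ q₀ : ℝ} {ψ χ ω : ℝ → ℝ}
    (h : DecayData τ σ q₀ ψ χ)
    (hdiv : ¬ Summable fun p : Nat.Primes => 1 / (((p : ℕ) : ℝ) * χ ((p : ℕ) : ℝ)))
    (hω : MonotoneOn ω (Set.Ioi 0)) (hω' : Tendsto ω atTop atTop) :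
    ∃ R₀ : ℝ, ∀ G, IsDecayingDensity G → ∀ ε : ℝ, 0 < ε → ∀ N₀ : ℕ,
      ∃ (H : ℝ → ℝ) (S : Set ℝ), IsDecayingDensity H ∧ IsClosed S ∧
        (∀ x, H x ≠ 0 → x ∈ S ∧ G x ≠ 0) ∧
        (∀ x ∈ S, ∃ q : ℕ, N₀ ≤ q ∧ 0 < q ∧ ∃ p : ℤ, |x - p / q| ≤ ψ q) ∧
        (∀ ξ : ℝ, R₀ ≤ |ξ| → ‖𝓕 (fun x => (H x : ℂ)) ξ - 𝓕 (fun x => (G x : ℂ)) ξ‖ ≤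
          ε * (ω |ξ| * decayRate ψ χ |ξ|)) ∧
        ‖𝓕 (fun x => (H x : ℂ)) 0 - 𝓕 (fun x => (G x : ℂ)) 0‖ ≤ ε := by
  obtain ⟨C, hC, hmult⟩ := h.exists_isMultiplier hdiv
  obtain ⟨T, hT, hlat⟩ := exists_tsum_lattice_le
  obtain ⟨a, ha, hΘa⟩ := h.exists_le_decayRate
  obtain ⟨R₀, hR₀⟩ := eventually_atTop.1 ((eventually_ge_atTop 1).and
    ((hω'.eventually_ge_atTop 1).and (hΘa.and h.eventually_decayRate_le)))
  refine ⟨R₀, fun G hG ε hε N₀ => ?_⟩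
  obtain ⟨C₁, hC₁, hGC⟩ := hG.decay
  set K := C₁ * (16 * C + 2 / a) with hK
  have hK0 : 0 < K := by positivity
  have ev1 : ∀ᶠ N : ℕ in atTop, K * T / ε ≤ ω ((N : ℝ) / 2) :=
    (hω'.comp (tendsto_natCast_atTop_atTop.atTop_div_const two_pos)).eventually_ge_atTop _
  have ev2 : ∀ᶠ N : ℕ in atTop, 2 * C₁ * T * (N : ℝ) ^ (-(1 / 12) : ℝ) ≤ ε * min a 1 := by
    have h1 : Tendsto (fun N : ℕ => 2 * C₁ * T * (N : ℝ) ^ (-(1 / 12) : ℝ)) atTop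
        (𝓝 (2 * C₁ * T * 0)) :=
      ((tendsto_rpow_neg_atTop (by norm_num : (0 : ℝ) < 1 / 12)).comp
        tendsto_natCast_atTop_atTop).const_mul _
    rw [mul_zero] at h1
    exact h1.eventually_le_const (by positivity)
  obtain ⟨N, ⟨F, c, S, hF⟩, hN1, hN2, hN3, hN4, hN5⟩ := (hmult.and (ev1.and (ev2.and
    ((eventually_ge_atTop N₀).and ((eventually_ge_atTop 1).and
      (eventually_ge_atTop ⌈2 * R₀⌉₊)))))).exists
  have hN0 : (1 : ℝ) ≤ N := by exact_mod_cast hN4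
  have hNR : R₀ ≤ (N : ℝ) / 2 := by
    have := Nat.ceil_le.1 hN5
    linarith
  have hlow : ∀ ξ : ℝ, |ξ| < N / 2 →
      ‖𝓕 (fun x => ((G x * F x : ℝ) : ℂ)) ξ - 𝓕 (fun x => (G x : ℂ)) ξ‖ ≤
        ε * (min a 1 * (N : ℝ) ^ (-(2 / 3) : ℝ)) := by
    intro ξ hξ
    have := hF.norm_fourier_mul_sub_le hG (ξ := ξ) (B := C₁ * (2 * (N : ℝ) ^ (-(3 / 4) : ℝ))) hGC
      (hlat ξ).1 (hlat ξ).2 (by positivity) fun k hk => ?_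
    · refine this.trans ?_
      rw [show (-(3 / 4) : ℝ) = -(1 / 12) + -(2 / 3) by norm_num, Real.rpow_add (by linarith)]
      have h2 := mul_le_mul_of_nonneg_right hN2
        (Real.rpow_nonneg (show (0 : ℝ) ≤ N by linarith) (-(2 / 3)))
      linarith
    · have h1 : (N : ℝ) ≤ |(k : ℝ)| := by
        rw [← Int.cast_abs, ← Nat.cast_natAbs]
        exact_mod_cast hk
      have h2 : (N : ℝ) / 2 ≤ |ξ - k| := by
        have := abs_sub_abs_le_abs_sub (k : ℝ) ξ
        rw [abs_sub_comm] at this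
        linarith
      have h3 := rpow_neg_three_quarters_half_le (by linarith : (0 : ℝ) < N) h2
      calc ‖c k‖ * (C₁ * (1 + |ξ - k|) ^ (-(3 / 4) : ℝ))
          ≤ 1 * (C₁ * (2 * (N : ℝ) ^ (-(3 / 4) : ℝ))) := by
            gcongr
            exact hF.norm_coeff_le_one k
        _ = _ := one_mul _
  refine ⟨fun x => G x * F x, S, hF.isDecayingDensity_mul hG, hF.isClosed,
    fun x hx => ⟨hF.mem_of_ne_zero x (right_ne_zero_of_mul hx), left_ne_zero_of_mul hx⟩,
    fun x hx => ?_, fun ξ hξ => ?_, ?_⟩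
  · obtain ⟨q, hq, hq'⟩ := hF.approx x hx
    exact ⟨q, hN3.trans hq, hq'⟩
  · obtain ⟨hξ1, hω1, hΘ, hΘ16⟩ := hR₀ |ξ| hξ
    have hξ0 : 0 < |ξ| := by linarith
    have hΘ0 : 0 < decayRate ψ χ |ξ| := lt_of_lt_of_le (by positivity) hΘ
    rcases lt_or_ge |ξ| (N / 2) with hlt | hge
    · refine (hlow ξ hlt).trans (mul_le_mul_of_nonneg_left ?_ hε.le)
      calc min a 1 * (N : ℝ) ^ (-(2 / 3) : ℝ) ≤ a * |ξ| ^ (-(2 / 3) : ℝ) := by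
            gcongr ?_ * ?_
            · exact min_le_left _ _
            · exact Real.rpow_le_rpow_of_nonpos hξ0 (by linarith) (by norm_num)
        _ ≤ decayRate ψ χ |ξ| := hΘ
        _ ≤ ω |ξ| * decayRate ψ χ |ξ| := le_mul_of_one_le_left hΘ0.le hω1
    · have := hF.norm_fourier_mul_sub_le hG (ξ := ξ) (B := K * decayRate ψ χ |ξ|) hGC
        (hlat ξ).1 (hlat ξ).2 (by positivity) fun k hk => ?_
      · refine this.trans ?_
        have h1 : K * T / ε ≤ ω |ξ| := hN1.trans (hω (by simp; linarith) hξ0 hge)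
        rw [div_le_iff₀ hε] at h1
        calc K * decayRate ψ χ |ξ| * T = (K * T) * decayRate ψ χ |ξ| := by ring
          _ ≤ ω |ξ| * ε * decayRate ψ χ |ξ| := by gcongr
          _ = _ := by ring
      · rw [hK]
        rcases le_or_gt (|ξ| / 2) |(k : ℝ)| with hle | hgt
        · have h1 : (1 + |ξ - k|) ^ (-(3 / 4) : ℝ) ≤ 1 :=
            Real.rpow_le_one_of_one_le_of_nonpos (by linarith [abs_nonneg (ξ - k)]) (by norm_num)
          calc ‖c k‖ * (C₁ * (1 + |ξ - k|) ^ (-(3 / 4) : ℝ))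
              ≤ (C * (16 * decayRate ψ χ |ξ|)) * (C₁ * 1) := by
                gcongr
                exact (hF.norm_coeff_le k hk).trans (by gcongr; exact hΘ16 _ hle)
            _ = C₁ * (16 * C + 0) * decayRate ψ χ |ξ| := by ring
            _ ≤ _ := by gcongr; positivity
        · have h2 : |ξ| / 2 ≤ |ξ - k| := by
            have := abs_sub_abs_le_abs_sub ξ (k : ℝ)
            linarith
          have h3 := rpow_neg_three_quarters_half_le hξ0 h2
          have h4 : |ξ| ^ (-(3 / 4) : ℝ) ≤ |ξ| ^ (-(2 / 3) : ℝ) :=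
            Real.rpow_le_rpow_of_exponent_le hξ1 (by norm_num)
          have h5 : |ξ| ^ (-(2 / 3) : ℝ) ≤ decayRate ψ χ |ξ| / a := by
            rw [le_div_iff₀ ha]
            linarith
          calc ‖c k‖ * (C₁ * (1 + |ξ - k|) ^ (-(3 / 4) : ℝ))
              ≤ 1 * (C₁ * (2 * (decayRate ψ χ |ξ| / a))) := by
                gcongr
                · exact hF.norm_coeff_le_one k
                · exact h3.trans (by gcongr; exact h4.trans h5)
            _ = C₁ * (0 + 2 / a) * decayRate ψ χ |ξ| := by ring
            _ ≤ _ := by gcongr; positivity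
  · refine (hlow 0 (by rw [abs_zero]; linarith)).trans ?_
    have h1 : min a 1 * (N : ℝ) ^ (-(2 / 3) : ℝ) ≤ 1 * 1 := by
      gcongr
      · exact min_le_right _ _
      · exact Real.rpow_le_one_of_one_le_of_nonpos hN0 (by norm_num)
    nlinarith

/-! ### The limit measure -/

theorem norm_measureFourier_le_one (μ : Measure ℝ) [IsProbabilityMeasure μ] (ξ : ℝ) :
    ‖measureFourier μ ξ‖ ≤ 1 := by
  refine (norm_integral_le_integral_norm _).trans_eq ?_
  have : ∀ x : ℝ, ‖Complex.exp (-(2 * Real.pi * ξ * x : ℝ) * Complex.I)‖ = 1 := fun x => by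
    rw [← Complex.ofReal_neg]
    exact Complex.norm_exp_ofReal_mul_I _
  simp_rw [this]
  simp

/-- The normalization of a density, as a probability measure. -/
theorem IsDecayingDensity.exists_probabilityMeasure {G : ℝ → ℝ} (hG : IsDecayingDensity G)
    (hpos : 0 < ∫ x, G x) : ∃ μ : ProbabilityMeasure ℝ,
      (∀ S : Set ℝ, MeasurableSet S → (∀ x, G x ≠ 0 → x ∈ S) → (μ : Measure ℝ) Sᶜ = 0) ∧
      ∀ ξ, measureFourier μ ξ = ((1 / ∫ x, G x : ℝ) : ℂ) * 𝓕 (fun x => (G x : ℂ)) ξ := by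
  set m := ∫ x, G x
  have hmeas : Measurable fun x => ENNReal.ofReal (G x / m) :=
    (hG.continuous.div_const m).measurable.ennreal_ofReal
  have h0 : ∀ x, 0 ≤ G x / m := fun x => div_nonneg (hG.nonneg x) hpos.le
  have hprob : IsProbabilityMeasure (volume.withDensity fun x => ENNReal.ofReal (G x / m)) := by
    constructor
    rw [withDensity_apply _ MeasurableSet.univ, Measure.restrict_univ,
      ← ofReal_integral_eq_lintegral_ofReal (hG.integrable.div_const m) (Eventually.of_forall h0),
      integral_div, div_self hpos.ne', ENNReal.ofReal_one]
  refine ⟨⟨_, hprob⟩, fun S hS hGS => ?_, fun ξ => ?_⟩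
  · change (volume.withDensity fun x => ENNReal.ofReal (G x / m)) Sᶜ = 0
    rw [withDensity_apply _ hS.compl, setLIntegral_eq_zero_iff hS.compl hmeas]
    refine Eventually.of_forall fun x hx => ?_
    have : G x = 0 := by
      by_contra hne
      exact hx (hGS x hne)
    simp [this]
  · change ∫ x, _ ∂(volume.withDensity fun x => ENNReal.ofReal (G x / m)) = _
    rw [integral_withDensity_eq_integral_toReal_smul hmeas
      (Eventually.of_forall fun x => ENNReal.ofReal_lt_top),
      Real.fourier_real_eq_integral_exp_smul, ← integral_const_mul]
    congr 1
    ext x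
    rw [ENNReal.toReal_ofReal (h0 x), Complex.real_smul, smul_eq_mul,
      show (-2 * Real.pi * x * ξ) = -(2 * Real.pi * ξ * x) by ring]
    push_cast
    ring

theorem tendsto_measureFourier {ι : Type*} {L : Filter ι}
    {μs : ι → ProbabilityMeasure ℝ} {μ : ProbabilityMeasure ℝ} (h : Tendsto μs L (𝓝 μ)) (ξ : ℝ) :
    Tendsto (fun i => measureFourier (μs i) ξ) L (𝓝 (measureFourier μ ξ)) := by
  have := (ProbabilityMeasure.tendsto_iff_forall_integral_rclike_tendsto ℂ).1 h
    (BoundedContinuousFunction.ofNormedAddCommGroup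
      (fun x : ℝ => Complex.exp (-(2 * Real.pi * ξ * x : ℝ) * Complex.I)) (by fun_prop) 1
      fun x => by
        rw [← Complex.ofReal_neg]
        exact (Complex.norm_exp_ofReal_mul_I _).le)
  exact this

/-- A weak limit point along an ultrafilter of measures carried by `[-1, 1]` is carried by every
closed set that carries all but finitely many of them. -/
theorem exists_limit_of_measure_compl_Icc_eq_zero (μs : ℕ → ProbabilityMeasure ℝ)
    (h : ∀ n, (μs n : Measure ℝ) (Set.Icc (-1) 1)ᶜ = 0) :
    ∃ μ : ProbabilityMeasure ℝ, Tendsto μs (hyperfilter ℕ) (𝓝 μ) ∧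
      ∀ S : Set ℝ, IsClosed S → (∀ᶠ n in atTop, (μs n : Measure ℝ) Sᶜ = 0) →
        (μ : Measure ℝ) Sᶜ = 0 := by
  have hcomp := isCompact_setOfPred_probabilityMeasure_mass_eq_compl_isCompact_le (E := ℝ)
    (u := fun _ => 0) (K := fun _ => Set.Icc (-1) 1) tendsto_const_nhds (fun _ => isCompact_Icc)
    (Or.inl inferInstance)
  obtain ⟨μ, -, hμ⟩ := hcomp.ultrafilter_le_nhds' ((hyperfilter ℕ).map μs) (by
    refine Filter.mem_map.2 (Filter.univ_mem' fun n _ => ?_)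
    rw [nonpos_iff_eq_zero, ProbabilityMeasure.null_iff_toMeasure_null]
    exact h n)
  have hlim : Tendsto μs (hyperfilter ℕ) (𝓝 μ) := hμ
  refine ⟨μ, hlim, fun S hS hSn => ?_⟩
  have h1 := ProbabilityMeasure.le_liminf_measure_open_of_tendsto hlim hS.isOpen_compl
  have h2 : ∀ᶠ n in (hyperfilter ℕ : Filter ℕ), (μs n : Measure ℝ) Sᶜ = 0 :=
    Nat.hyperfilter_le_atTop hSn
  rw [liminf_congr h2, liminf_const] at h1
  exact nonpos_iff_eq_zero.1 h1

/-- Iterating the multiplication step with errors `2 ^ (-n - 2)` gives densities whose Fourier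
transforms stay within `ω * decayRate / 2` of the first one. -/
theorem DecayData.exists_seq {τ σ q₀ : ℝ} {ψ χ ω : ℝ → ℝ} (h : DecayData τ σ q₀ ψ χ)
    (hdiv : ¬ Summable fun p : Nat.Primes => 1 / (((p : ℕ) : ℝ) * χ ((p : ℕ) : ℝ)))
    (hω : MonotoneOn ω (Set.Ioi 0)) (hω' : Tendsto ω atTop atTop) :
    ∃ (R₀ : ℝ) (G : ℕ → ℝ → ℝ) (S : ℕ → Set ℝ), (∀ n, IsDecayingDensity (G n)) ∧
      (∀ n, IsClosed (S n)) ∧ (∀ i n, i < n → ∀ x, G n x ≠ 0 → x ∈ S i) ∧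
      (∀ n, ∀ x ∈ S n, ∃ q : ℕ, n ≤ q ∧ 0 < q ∧ ∃ p : ℤ, |x - p / q| ≤ ψ q) ∧
      (∀ n ξ, R₀ ≤ |ξ| → ‖𝓕 (fun x => (G n x : ℂ)) ξ - 𝓕 (fun x => (G 0 x : ℂ)) ξ‖ ≤
        1 / 2 * (ω |ξ| * decayRate ψ χ |ξ|)) ∧
      (∀ n, |(∫ x, G n x) - 1| ≤ 1 / 2) := by
  obtain ⟨R₀, hstep⟩ := h.exists_mul_isDecayingDensity hdiv hω hω'
  obtain ⟨G₀, hG₀, hG₀1⟩ := exists_isDecayingDensity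
  choose! H T hH using hstep
  let ε : ℕ → ℝ := fun n => 1 / 4 * (1 / 2) ^ n
  have hε : ∀ n, 0 < ε n := fun n => by positivity
  obtain ⟨G, hG0, hGs⟩ : ∃ G : ℕ → ℝ → ℝ, G 0 = G₀ ∧ ∀ n, G (n + 1) = H (G n) (ε n) n :=
    ⟨fun n => Nat.rec G₀ (fun n g => H g (ε n) n) n, rfl, fun _ => rfl⟩
  have hG : ∀ n, IsDecayingDensity (G n) := by
    intro n
    induction n with
    | zero => rwa [hG0]
    | succ n ih => rw [hGs]; exact (hH (G n) ih (ε n) (hε n) n).1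
  have hnext := fun n => hH (G n) (hG n) (ε n) (hε n) n
  simp only [← hGs] at hnext
  have hsum : ∀ (ξ X : ℝ), (∀ n, ‖𝓕 (fun x => (G (n + 1) x : ℂ)) ξ - 𝓕 (fun x => (G n x : ℂ)) ξ‖ ≤
      ε n * X) → ∀ n, ‖𝓕 (fun x => (G n x : ℂ)) ξ - 𝓕 (fun x => (G 0 x : ℂ)) ξ‖ ≤ 1 / 2 * X := by
    intro ξ X hX n
    have hX0 : 0 ≤ X := nonneg_of_mul_nonneg_right ((norm_nonneg _).trans (hX 0)) (hε 0)
    suffices ‖𝓕 (fun x => (G n x : ℂ)) ξ - 𝓕 (fun x => (G 0 x : ℂ)) ξ‖ ≤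
        (1 / 2 - 1 / 2 * (1 / 2) ^ n) * X by
      refine this.trans ?_
      gcongr
      have : (0 : ℝ) ≤ 1 / 2 * (1 / 2) ^ n := by positivity
      linarith
    induction n with
    | zero => simp
    | succ n ih =>
      refine (norm_sub_le_norm_sub_add_norm_sub _ (𝓕 (fun x => (G n x : ℂ)) ξ) _).trans ?_
      refine (add_le_add (hX n) ih).trans_eq ?_
      simp only [ε, pow_succ]
      ring
  refine ⟨R₀, G, fun n => T (G n) (ε n) n, hG, fun n => (hnext n).2.1, ?_,
    fun n => (hnext n).2.2.2.1, fun n ξ hξ => hsum ξ _ (fun n => (hnext n).2.2.2.2.1 ξ hξ) n,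
    fun n => ?_⟩
  · intro i n hin x hx
    induction n, hin using Nat.le_induction with
    | base => exact ((hnext i).2.2.1 x hx).1
    | succ n _ ih => exact ih ((hnext n).2.2.1 x hx).2
  · have h1 := hsum 0 1 (fun n => by rw [mul_one]; exact (hnext n).2.2.2.2.2) n
    have h2 : ∫ x, G 0 x = 1 := by rw [hG0, hG₀1]
    rw [fourier_zero_eq, fourier_zero_eq, h2, ← Complex.ofReal_sub, Complex.norm_real,
      Real.norm_eq_abs] at h1
    linarith

theorem approximable_of_forall_exists {ψ : ℝ → ℝ} {x : ℝ}
    (hx : ∀ n : ℕ, ∃ q : ℕ, n ≤ q ∧ 0 < q ∧ ∃ p : ℤ, |x - p / q| ≤ ψ q) :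
    x ∈ approximableSet ψ := by
  refine Set.Infinite.of_image Prod.snd (Set.infinite_of_forall_exists_gt fun n => ?_)
  obtain ⟨q, hq, hq0, p, hp⟩ := hx (n + 1)
  exact ⟨q, ⟨(p, q), ⟨hq0, hp⟩, rfl⟩, hq⟩

theorem DecayData.exists_measure {τ σ q₀ : ℝ} {ψ χ ω : ℝ → ℝ} (h : DecayData τ σ q₀ ψ χ)
    (hdiv : ¬ Summable fun p : Nat.Primes => 1 / (((p : ℕ) : ℝ) * χ ((p : ℕ) : ℝ)))
    (hω : MonotoneOn ω (Set.Ioi 0)) (hω' : Tendsto ω atTop atTop) :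
    ∃ μ : Measure ℝ, IsProbabilityMeasure μ ∧
      (∃ K : Set ℝ, IsCompact K ∧ K ⊆ approximableSet ψ ∧ μ Kᶜ = 0) ∧
      ∃ R : ℝ, ∀ ξ : ℝ, R ≤ |ξ| → ‖measureFourier μ ξ‖ ≤ 2 * (ω |ξ| * decayRate ψ χ |ξ|) := by
  obtain ⟨R₀, G, S, hG, hS, hGS, hSψ, hbd, hmass⟩ := h.exists_seq hdiv hω hω'
  have hpos : ∀ n, 1 / 2 ≤ ∫ x, G n x := fun n => by
    have := (abs_le.1 (hmass n)).1
    linarith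
  choose μs hμs hμsF using fun n => (hG n).exists_probabilityMeasure
    (lt_of_lt_of_le one_half_pos (hpos n))
  obtain ⟨μ, hμ, hμS⟩ := exists_limit_of_measure_compl_Icc_eq_zero μs fun n =>
    hμs n _ measurableSet_Icc fun x hx => abs_le.1 ((hG n).abs_le_one x hx)
  refine ⟨μ, inferInstance, ⟨Set.Icc (-1) 1 ∩ ⋂ i, S i, ?_, ?_, ?_⟩, ?_⟩
  · exact isCompact_Icc.inter_right (isClosed_iInter hS)
  · rintro x ⟨-, hx⟩
    exact approximable_of_forall_exists fun n => hSψ n x (Set.mem_iInter.1 hx n)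
  · rw [Set.compl_inter, Set.compl_iInter]
    refine measure_union_null (hμS _ isClosed_Icc (Eventually.of_forall fun n => ?_))
      (measure_iUnion_null fun i => hμS _ (hS i) ?_)
    · exact hμs n _ measurableSet_Icc fun x hx => abs_le.1 ((hG n).abs_le_one x hx)
    · filter_upwards [eventually_gt_atTop i] with n hn
      exact hμs n _ (hS i).measurableSet (hGS i n hn)
  · obtain ⟨C, hC, hdecay⟩ := (hG 0).decay
    obtain ⟨a, ha, hΘa⟩ := h.exists_le_decayRate
    obtain ⟨R₁, hR₁⟩ := eventually_atTop.1 ((eventually_ge_atTop (max R₀ 1)).and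
      ((hω'.eventually_ge_atTop (2 * C / a)).and hΘa))
    refine ⟨R₁, fun ξ hξ => ?_⟩
    obtain ⟨hξR, hωξ, hΘ⟩ := hR₁ _ hξ
    simp only [max_le_iff] at hξR
    have hξ0 : 0 < |ξ| := by linarith
    have hX : 2 * (C * (1 / (1 + |ξ|) ^ 2)) ≤ ω |ξ| * decayRate ψ χ |ξ| := by
      have h1 : 1 / (1 + |ξ|) ^ 2 ≤ |ξ| ^ (-(2 / 3) : ℝ) := by
        refine (one_div_sq_le_rpow (by linarith)).trans ?_
        refine (Real.rpow_le_rpow_of_nonpos hξ0 (by linarith) (by norm_num)).trans ?_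
        exact Real.rpow_le_rpow_of_exponent_le hξR.2 (by norm_num)
      calc 2 * (C * (1 / (1 + |ξ|) ^ 2)) ≤ 2 * (C * |ξ| ^ (-(2 / 3) : ℝ)) := by gcongr
        _ = 2 * C / a * (a * |ξ| ^ (-(2 / 3) : ℝ)) := by field_simp
        _ ≤ ω |ξ| * decayRate ψ χ |ξ| := by
          have : 0 ≤ ω |ξ| := le_trans (by positivity) hωξ
          gcongr
    refine le_of_tendsto (tendsto_measureFourier hμ ξ).norm
      (Eventually.of_forall fun n => ?_)
    rw [hμsF n ξ, norm_mul, Complex.norm_real, Real.norm_of_nonneg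
      (one_div_nonneg.2 (by linarith [hpos n]))]
    have h2 : 1 / ∫ x, G n x ≤ 2 := by
      rw [div_le_iff₀ (by linarith [hpos n])]
      linarith [hpos n]
    have h3 := norm_le_norm_add_norm_sub' (𝓕 (fun x => (G n x : ℂ)) ξ) (𝓕 (fun x => (G 0 x : ℂ)) ξ)
    have h4 := hbd n ξ hξR.1
    have h5 := hdecay ξ
    calc _ ≤ 2 * ‖𝓕 (fun x => (G n x : ℂ)) ξ‖ := by gcongr
      _ ≤ _ := by linarith

/-! ### Pure powers, bounded frequencies and the conclusion -/

theorem decreasingInverse_rpow {ψ : ℝ → ℝ} {τ x : ℝ} (hτ : 0 < τ)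
    (hψ : ∀ q : ℝ, 1 ≤ q → ψ q = q ^ (-τ)) (hx : 1 ≤ x) :
    decreasingInverse ψ (1 / x) = x ^ (1 / τ) := by
  have hx0 : 0 < x := by linarith
  have hmem : x ^ (1 / τ) ∈ {q : ℝ | 1 ≤ q ∧ 1 / x ≤ ψ q} := by
    have h1 : 1 ≤ x ^ (1 / τ) := Real.one_le_rpow hx (by positivity)
    refine ⟨h1, ?_⟩
    rw [hψ _ h1, ← Real.rpow_mul hx0.le, mul_neg, one_div_mul_cancel hτ.ne', Real.rpow_neg_one,
      one_div]
  refine IsGreatest.csSup_eq ⟨hmem, ?_⟩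
  rintro q ⟨hq, hqx⟩
  have hq0 : 0 < q := by linarith
  rw [hψ q hq, Real.rpow_neg hq0.le, ← one_div,
    one_div_le_one_div hx0 (Real.rpow_pos_of_pos hq0 _)] at hqx
  calc q = (q ^ τ) ^ (1 / τ) := by
        rw [← Real.rpow_mul hq0.le, mul_one_div_cancel hτ.ne', Real.rpow_one]
    _ ≤ x ^ (1 / τ) := Real.rpow_le_rpow (by positivity) hqx (by positivity)

/-- On a bounded range of `|ξ|` the right-hand side of the estimate is bounded below. -/
theorem DecayData.exists_pos_le {τ σ q₀ : ℝ} {ψ χ ω : ℝ → ℝ} (h : DecayData τ σ q₀ ψ χ)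
    (hω : MonotoneOn ω (Set.Ioi 0)) {R : ℝ} (hR : 0 < R) (hωR : 0 < ω R)
    (hq : q₀ ≤ decreasingInverse ψ (1 / R)) (R₁ : ℝ) :
    (∀ x, R ≤ x → 0 ≤ ω x * decayRate ψ χ x) ∧
      ∃ m : ℝ, 0 < m ∧ ∀ x, R ≤ x → x ≤ R₁ → m ≤ ω x * decayRate ψ χ x := by
  have hmono : ∀ x y, R ≤ x → x ≤ y →
      decreasingInverse ψ (1 / x) ≤ decreasingInverse ψ (1 / y) := fun x y hx hxy =>
    h.decreasingInverse_mono (one_div_pos.2 (by linarith))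
      (one_div_le_one_div_of_le (by linarith) hxy)
  have hD : ∀ x, R ≤ x → 0 < decreasingInverse ψ (1 / x) ∧
      1 ≤ χ (decreasingInverse ψ (1 / x)) ∧
      χ (decreasingInverse ψ (1 / x)) ≤ Real.log (decreasingInverse ψ (1 / x)) := by
    intro x hx
    have h1 := h.chi _ (hq.trans (hmono R x le_rfl hx))
    refine ⟨lt_of_le_of_ne (Real.sSup_nonneg fun q hq => by linarith [hq.1]) fun h0 => ?_, h1⟩
    -- the default value `0` of the inverse is excluded by `1 ≤ χ ≤ log`
    rw [← h0, Real.log_zero] at h1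
    linarith
  have hωx : ∀ x, R ≤ x → ω R ≤ ω x := fun x hx => hω hR (hR.trans_le hx) hx
  constructor
  · intro x hx
    obtain ⟨h1, h2, -⟩ := hD x hx
    have := hωx x hx
    have : 0 < ω x := by linarith
    unfold decayRate
    positivity
  · have hM := hD (max R R₁) (le_max_left _ _)
    set M := decreasingInverse ψ (1 / max R R₁)
    have hlog : 0 < Real.log M := by linarith
    have hM0 : 0 < M := hM.1
    refine ⟨ω R * (1 / (M * Real.log M)), by positivity, fun x hx hxR => ?_⟩
    obtain ⟨h1, h2, h3⟩ := hD x hx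
    have h4 := hmono x _ hx (hxR.trans (le_max_right R R₁))
    unfold decayRate
    have h5 : 0 ≤ ω x := hωR.le.trans (hωx x hx)
    gcongr
    · exact hωx x hx
    · exact h3.trans (Real.log_le_log h1 h4)

theorem theorem1 (τ σ : ℝ) (hτ : 2 < τ) (hσ : 1 < σ) :
    ∃ C : ℝ, 0 < C ∧
      ∀ (ψ χ ω : ℝ → ℝ) (q₀ : ℝ),
        -- `ψ` is nonnegative and decreasing
        (∀ q : ℝ, 1 ≤ q → 0 ≤ ψ q) →
        AntitoneOn ψ (Set.Ici 1) →
        -- `- log ψ(q) / log q` tends to `τ`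
        Tendsto (fun q : ℕ => -Real.log (ψ (q : ℝ)) / Real.log (q : ℝ)) atTop (𝓝 τ) →
        -- polynomial-type decay of `ψ`
        (∃ Q : ℕ, ∀ q₁ q₂ : ℕ, Q ≤ q₁ → q₁ < q₂ →
          ((q₂ : ℝ) / (q₁ : ℝ)) ^ σ ≤ ψ (q₁ : ℝ) / ψ (q₂ : ℝ)) →
        -- size of `χ`
        (∀ q : ℝ, q₀ ≤ q → 1 ≤ χ q ∧ χ q ≤ Real.log q) →
        -- divergence over the primes
        (¬ Summable fun p : Nat.Primes => 1 / (((p : ℕ) : ℝ) * χ ((p : ℕ) : ℝ))) →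
        -- subpolynomial-type growth of `χ`
        (∀ ε : ℝ, 0 < ε → ∃ Q : ℝ, ∀ q₁ q₂ : ℝ, Q ≤ q₁ → Q ≤ q₂ → q₁ ≠ q₂ →
          χ q₂ / χ q₁ < (max (q₂ / q₁) (q₁ / q₂)) ^ ε) →
        -- `ω` increases to infinity
        MonotoneOn ω (Set.Ioi 0) →
        Tendsto ω atTop atTop →
        ∃ μ : Measure ℝ, IsProbabilityMeasure μ ∧
          (∃ K : Set ℝ, IsCompact K ∧ K ⊆ approximableSet ψ ∧ μ Kᶜ = 0) ∧
          -- the estimate for large `|ξ|`, with a constant that depends only on `τ` and `σ`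
          (∃ R : ℝ, ∀ ξ : ℝ, R ≤ |ξ| →
            ‖measureFourier μ ξ‖ ≤ C * (ω |ξ| /
              (decreasingInverse ψ (1 / |ξ|) * χ (decreasingInverse ψ (1 / |ξ|))))) ∧
          -- the estimate on every range `|ξ| ≥ R` where its right-hand side makes sense
          (∀ R : ℝ, 0 < R → 0 < ω R → q₀ ≤ decreasingInverse ψ (1 / R) →
            ∃ C' : ℝ, 0 < C' ∧ ∀ ξ : ℝ, R ≤ |ξ| →
              ‖measureFourier μ ξ‖ ≤ C' * (ω |ξ| /
                (decreasingInverse ψ (1 / |ξ|) * χ (decreasingInverse ψ (1 / |ξ|))))) ∧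
          -- the case of a pure power
          ((∀ q : ℝ, 1 ≤ q → ψ q = q ^ (-τ)) →
            ∃ R : ℝ, ∀ ξ : ℝ, R ≤ |ξ| →
              ‖measureFourier μ ξ‖ ≤ C * (|ξ| ^ (-1 / τ) * (ω |ξ| / χ (|ξ| ^ (1 / τ))))) := by
  refine ⟨2, two_pos, fun ψ χ ω q₀ hnonneg hanti hlim hratio hchi hdiv hslow hω hω' => ?_⟩
  have h : DecayData τ σ q₀ ψ χ := ⟨hτ, hσ, hanti, hlim, hnonneg, hratio, hchi, hslow⟩
  obtain ⟨μ, hμ, hK, R₁, hR₁⟩ := h.exists_measure hdiv hω hω'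
  simp only [← mul_one_div (ω _) (decreasingInverse ψ _ * χ _), ← decayRate.eq_1]
  refine ⟨μ, hμ, hK, ⟨R₁, hR₁⟩, fun R hR hωR hq => ?_, fun hψ => ⟨max 1 R₁, fun ξ hξ => ?_⟩⟩
  · obtain ⟨h0, m, hm, hmle⟩ := h.exists_pos_le hω hR hωR hq R₁
    refine ⟨2 + 1 / m, by positivity, fun ξ hξ => ?_⟩
    have h1 := h0 _ hξ
    have h2 : 0 < 1 / m := by positivity
    rcases le_total R₁ |ξ| with hle | hle
    · refine (hR₁ ξ hle).trans ?_
      gcongr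
      linarith
    · have h3 := hmle _ hξ hle
      calc ‖measureFourier μ ξ‖ ≤ 1 := norm_measureFourier_le_one μ ξ
        _ = 1 / m * m := by field_simp
        _ ≤ (2 + 1 / m) * (ω |ξ| * decayRate ψ χ |ξ|) := by
          gcongr
          linarith
  · simp only [max_le_iff] at hξ
    refine (hR₁ ξ hξ.2).trans_eq ?_
    rw [decayRate, decreasingInverse_rpow (by linarith) hψ hξ.1, neg_div,
      Real.rpow_neg (abs_nonneg ξ)]
    ring
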